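/- Let $\nu$ be a $\sigma$-finite measure on a measurable space $\mathcal U$ and let $\mathcal P=\{P_{\mu}:\mu\in\mathtt M_p\}$ be a regular $d$-dimensional exponential family on $\mathcal U$ with sufficient statistic $X=X(U)\in\mathbb R^d$, in its mean-value parameterization ($\mathbb E_{P_\mu}[X]=\mu$), whose elements are mutually absolutely continuous with $\nu$ and have $\nu$-densities $p_\mu$. Let $Q$ be a probability distribution on $\mathcal U$, mutually absolutely continuous with $\nu$, with $\nu$-density $q$. All distributions are extended to $U^n=(U_1,\dots,U_n)$ by the i.i.d. assumption; $X^n=(X(U_1),\dots,X(U_n))$ and $Z=n^{-1/2}\sum_{i=1}^n X(U_i)$. For a set $\mathcal C$ of distributions on a sample space, an e-variable for $\mathcal C$ is a nonnegative measurable $S$ with $\mathbb E_P[S]\le 1$ for all $P\in\mathcal C$. The reverse information projection (RIPr) of a density $q$ (of a distribution $Q$) on $\mathrm{conv}(\mathcal C)$ is a sub-probability density $p_{\leftsquigarrow q}$ with $\mathbb E_{Q}[\log (q/p_{\leftsquigarrow q})]=\inf_{P\in\mathrm{conv}(\mathcal C)}D(Q\|P)$ such that $q/p_{\leftsquigarrow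 q}$ is an e-variable for $\mathcal C$ maximizing $\mathbb E_Q[\log S]$ among all e-variables $S$ for $\mathcal C$. Put $$S^{(n)}_{\mathrm{rip}}=\frac{q(U^n)}{p_{\leftsquigarrow q(U^n)}(U^n)},\qquad S^{(n)}_{\mathrm{seq\text{-}rip}}=\prod_{i=1}^n\frac{q(U_i)}{p_{\leftsquigarrow q(U_i)}(U_i)},\qquad S^{(n)}_{\mathrm{cond}}=\frac{q(U^n\mid Z)}{p(U^n\mid Z)},$$ where the first RIPr is on the convex hull of $\{P_\mu(U^n):\mu\in\mathtt M_p\}$, those in the second are on the convex hull of $\mathcal P$ for a single outcome, and where $q(\cdot\mid T)$, $p(\cdot\mid T)$, for a statistic $T$ sufficient for $\mathcal P$, denote densities, relative to a common underlying measure that may depend on $T$, of the regular conditional distribution of $U^n$ given $T$ under $Q$ and of the one common to all $P\in\mathcal P$. Suppose that the distribution of $X$ under $Q$ equals its distribution under $P_{\mu^*}$, for some $\mu^*\in\mathtt M_p$. Then for every $n\ge 1$, $q(U^n)/p_{\mu^*}(U^n)$ is a version of $S^{(n)}_{\mathrm{rip}}$ and of $S^{(n)}_{\mathrm{seq\text{-}rip}}$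 and, if $\mathcal U$ is a standard Borel space, of $S^{(n)}_{\mathrm{cond}}$ and of $q(U^n\mid X^n)/p(U^n\mid X^n)$. Moreover, $\nu^{n}$-almost everywhere, $$S^{(n)}_{\mathrm{rip}}=S^{(n)}_{\mathrm{seq\text{-}rip}}=S^{(n)}_{\mathrm{cond}}=\frac{q(U^n\mid X^n)}{p(U^n\mid X^n)}=\frac{q(U^n)}{p_{\mu^*}(U^n)}$$ for all versions of these statistics, where for the statements about $S^{(n)}_{\mathrm{rip}}$ and $S^{(n)}_{\mathrm{seq\text{-}rip}}$ it is assumed that $D(Q\|P_{\mu^*})<\infty$ (so that the RIPrs are essentially unique). Consequently, for every probability distribution $R\ll\nu$ on $\mathcal U$ for which $D_R(Q\|P_{\mu^*}):=\mathbb E_{U\sim R}[\log (q(U)/p_{\mu^*}(U))]\in[-\infty,\infty]$ is well-defined, the following expectations are well-defined and $$\mathbb E_{U^n\sim R}[\log S^{(n)}_{\mathrm{rip}}]=\mathbb E_{U^n\sim R}[\log S^{(n)}_{\mathrm{seq\text{-}rip}}]=\mathbb E_{U^n\sim R}[\log S^{(n)}_{\mathrm{cond}}]=\mathbb E_{U^n\sim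 R}\Big[\log\frac{q(U^n\mid X^n)}{p(U^n\mid X^n)}\Big]=n\,D_R(Q\|P_{\mu^*}).$$ -/

import Mathlib

open MeasureTheory ProbabilityTheory Filter
open scoped ENNReal NNReal RealInnerProductSpace

namespace EVal

noncomputable section

/-! ### Expected logarithms -/

/-- The expectation `E_μ[log S] ∈ [-∞, ∞]` of a nonnegative statistic `S`, computed as
`E_μ[(log S)⁺] - E_μ[(log S)⁻]`. It is meaningful when `LogExpDefined μ S` holds
(the undefined form `∞ - ∞` evaluates to `-∞`). -/
def expLog {Ω : Type*} [MeasurableSpace Ω] (μ : Measure Ω) (S : Ω → ℝ≥0∞) : EReal :=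
  ((∫⁻ ω, (ENNReal.log (S ω)).toENNReal ∂μ : ℝ≥0∞) : EReal)
    - ((∫⁻ ω, (-(ENNReal.log (S ω))).toENNReal ∂μ : ℝ≥0∞) : EReal)

/-- `E_μ[log S]` is well-defined: the positive or the negative part of `log S` is integrable. -/
def LogExpDefined {Ω : Type*} [MeasurableSpace Ω] (μ : Measure Ω) (S : Ω → ℝ≥0∞) : Prop :=
  ∫⁻ ω, (ENNReal.log (S ω)).toENNReal ∂μ ≠ ∞ ∨ ∫⁻ ω, (-(ENNReal.log (S ω))).toENNReal ∂μ ≠ ∞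

/-! ### E-variables and reverse information projections -/

/-- `S` is an e-variable for the null hypothesis `C`. -/
def IsEVariable {Ω : Type*} [MeasurableSpace Ω] (C : Set (Measure Ω)) (S : Ω → ℝ≥0∞) : Prop :=
  Measurable S ∧ ∀ P ∈ C, ∫⁻ ω, S ω ∂P ≤ 1

/-- The sub-probability density `r` (with respect to `ν`) is the reverse information projection
(RIPr), on the convex hull of `C`, of the distribution `Q` with density `q`:
`E_Q[log (q / r)]` equals the infimum of `D(Q ‖ P)` over the convex hull of `C`, and `q / r` is the
growth-rate optimal e-variable, i.e. it maximizes `E_Q[log S]` over all e-variables `S`. -/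
structure IsRIPr {Ω : Type*} [MeasurableSpace Ω] (ν : Measure Ω) (q : Ω → ℝ≥0∞)
    (C : Set (Measure Ω)) (r : Ω → ℝ≥0∞) : Prop where
  measurable : Measurable r
  subprob : ∫⁻ ω, r ω ∂ν ≤ 1
  kl_eq : expLog (ν.withDensity q) (fun ω => q ω / r ω) =
    ((⨅ P ∈ convexHull ℝ≥0 C, InformationTheory.klDiv (ν.withDensity q) P : ℝ≥0∞) : EReal)
  eVariable : IsEVariable C (fun ω => q ω / r ω)
  optimal : ∀ S : Ω → ℝ≥0∞, IsEVariable C S →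
    expLog (ν.withDensity q) S ≤ expLog (ν.withDensity q) (fun ω => q ω / r ω)

/-- `S` is (a version of) the RIPr e-variable `q / r`, `r` the RIPr of `q` on the convex hull
of `C`. -/
def IsRIPrEVar {Ω : Type*} [MeasurableSpace Ω] (ν : Measure Ω) (q : Ω → ℝ≥0∞)
    (C : Set (Measure Ω)) (S : Ω → ℝ≥0∞) : Prop :=
  ∃ r : Ω → ℝ≥0∞, IsRIPr ν q C r ∧ S =ᵐ[ν] fun ω => q ω / r ω

/-- The outcomes strictly before time `i`. -/
def past {𝒰 : Type*} {n : ℕ} (u : Fin n → 𝒰) (i : Fin n) : Fin (i : ℕ) → 𝒰 :=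
  fun j => u ⟨j, j.2.trans i.2⟩

/-- `S` is (a version of) the sequentialized RIPr e-variable
`∏ i, qc(u_i | u^{i-1}) / r_i(u_i | u^{i-1})` at sample size `n`, where `qc i v` is the conditional
density of an outcome given the `i` previous outcomes `v` under the alternative, and where, for each
past `v`, `r i v` is the RIPr of `qc i v` on the convex hull of the single-outcome null `C`. -/
def IsSeqRIPrEVar {𝒰 : Type*} [MeasurableSpace 𝒰] (ν : Measure 𝒰)
    (qc : (i : ℕ) → (Fin i → 𝒰) → 𝒰 → ℝ≥0∞) (C : Set (Measure 𝒰)) (n : ℕ)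
    (S : (Fin n → 𝒰) → ℝ≥0∞) : Prop :=
  ∃ r : (i : ℕ) → (Fin i → 𝒰) → 𝒰 → ℝ≥0∞,
    (∀ i, Measurable (Function.uncurry (r i))) ∧
    (∀ i < n, ∀ v, IsRIPr ν (qc i v) C (r i v)) ∧
    S =ᵐ[Measure.pi fun _ => ν] fun u =>
      ∏ i : Fin n, qc i (past u i) (u i) / r i (past u i) (u i)

/-! ### Conditional likelihood ratios -/

/-- The Markov kernel `κ` is a regular conditional distribution of the data given the statistic `T`
when the data have distribution `P`. -/
def IsRegCondDistrib {Ω 𝒯 : Type*} [MeasurableSpace Ω] [MeasurableSpace 𝒯] (P : Measure Ω)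
    (T : Ω → 𝒯) (κ : Kernel 𝒯 Ω) : Prop :=
  IsMarkovKernel κ ∧ P.map (fun ω => (T ω, ω)) = (P.map T) ⊗ₘ κ

/-- `S` is (a version of) the conditional likelihood ratio `q(ω | T) / p(ω | T)`. Here `κP` is a
regular conditional distribution of the data given `T` common to all elements of the null `C`, `κQ`
is one for the alternative `Q`, and `p(· | z)`, `q(· | z)` are jointly measurable densities of
`κP z`, `κQ z` relative to a common underlying measure `ν' z`. -/
def IsCondLR {Ω 𝒯 : Type*} [MeasurableSpace Ω] [MeasurableSpace 𝒯] (ν : Measure Ω)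
    (Q : Measure Ω) (C : Set (Measure Ω)) (T : Ω → 𝒯) (S : Ω → ℝ≥0∞) : Prop :=
  ∃ (κP κQ ν' : Kernel 𝒯 Ω) (p q : 𝒯 → Ω → ℝ≥0∞),
    (∀ P ∈ C, IsRegCondDistrib P T κP) ∧ IsRegCondDistrib Q T κQ ∧
    Measurable (Function.uncurry p) ∧ Measurable (Function.uncurry q) ∧
    (∀ z, κP z = (ν' z).withDensity (p z)) ∧ (∀ z, κQ z = (ν' z).withDensity (q z)) ∧
    S =ᵐ[ν] fun ω => q (T ω) ω / p (T ω) ω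

/-! ### Regular exponential families in their mean-value parameterization -/

/-- A regular `d`-dimensional exponential family on `𝒰` with sufficient statistic `X`, whose
elements are mutually absolutely continuous with `ν`. Its elements have `ν`-densities proportional
to `exp ⟪β, X u⟫ * carrier u`, where `β` ranges over all vectors for which this can be normalized;
the set of these `β` is open (regularity), and `X` is not almost surely contained in a hyperplane
(so that the family is truly `d`-dimensional). -/
structure RegularExpFamily {𝒰 : Type*} [MeasurableSpace 𝒰] (ν : Measure 𝒰) (d : ℕ) where
  X : 𝒰 → EuclideanSpace ℝ (Fin d)
  carrier : 𝒰 → ℝ≥0∞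
  measurable_X : Measurable X
  measurable_carrier : Measurable carrier
  carrier_ne_zero : ∀ᵐ u ∂ν, carrier u ≠ 0
  isOpen_canonical : IsOpen {β : EuclideanSpace ℝ (Fin d) |
    ∫⁻ u, ENNReal.ofReal (Real.exp ⟪β, X u⟫) * carrier u ∂ν < ∞}
  minimal : ∀ (v : EuclideanSpace ℝ (Fin d)) (c : ℝ), v ≠ 0 → ¬ ∀ᵐ u ∂ν, ⟪v, X u⟫ = c

namespace RegularExpFamily

variable {𝒰 : Type*} [MeasurableSpace 𝒰] {ν : Measure 𝒰} {d : ℕ}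

/-- The normalizing constant. -/
def normalizer (F : RegularExpFamily ν d) (β : EuclideanSpace ℝ (Fin d)) : ℝ≥0∞ :=
  ∫⁻ u, ENNReal.ofReal (Real.exp ⟪β, F.X u⟫) * F.carrier u ∂ν

/-- The canonical parameter space. -/
def canonicalSpace (F : RegularExpFamily ν d) : Set (EuclideanSpace ℝ (Fin d)) :=
  {β | F.normalizer β < ∞}

/-- The density of the element with canonical parameter `β`. -/
def canonicalDensity (F : RegularExpFamily ν d) (β : EuclideanSpace ℝ (Fin d)) (u : 𝒰) : ℝ≥0∞ :=
  ENNReal.ofReal (Real.exp ⟪β, F.X u⟫) * F.carrier u / F.normalizer β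

/-- The mean of `X` under the element with canonical parameter `β`. -/
def meanOf (F : RegularExpFamily ν d) (β : EuclideanSpace ℝ (Fin d)) :
    EuclideanSpace ℝ (Fin d) :=
  ∫ u, F.X u ∂(ν.withDensity (F.canonicalDensity β))

/-- The mean-value parameter space. -/
def meanSpace (F : RegularExpFamily ν d) : Set (EuclideanSpace ℝ (Fin d)) :=
  F.meanOf '' F.canonicalSpace

open scoped Classical in
/-- The canonical parameter corresponding to the mean-value parameter `μ` (`0` if `μ` is not in the
mean-value parameter space). -/
def canonicalOf (F : RegularExpFamily ν d) (μ : EuclideanSpace ℝ (Fin d)) :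
    EuclideanSpace ℝ (Fin d) :=
  if h : ∃ β ∈ F.canonicalSpace, F.meanOf β = μ then h.choose else 0

/-- The density `p_μ` of the element with mean-value parameter `μ`. -/
def density (F : RegularExpFamily ν d) (μ : EuclideanSpace ℝ (Fin d)) : 𝒰 → ℝ≥0∞ :=
  F.canonicalDensity (F.canonicalOf μ)

/-- The element `P_μ` with mean-value parameter `μ`. -/
def dist (F : RegularExpFamily ν d) (μ : EuclideanSpace ℝ (Fin d)) : Measure 𝒰 :=
  ν.withDensity (F.density μ)

/-- The null hypothesis for a single outcome. -/
def null (F : RegularExpFamily ν d) : Set (Measure 𝒰) :=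
  {P | ∃ μ ∈ F.meanSpace, P = F.dist μ}

/-- The null hypothesis for `n` i.i.d. outcomes. -/
def nullN (F : RegularExpFamily ν d) (n : ℕ) : Set (Measure (Fin n → 𝒰)) :=
  {P | ∃ μ ∈ F.meanSpace, P = Measure.pi fun _ => F.dist μ}

/-- The statistic `Xⁿ = (X_1, …, X_n)`. -/
def Xn (F : RegularExpFamily ν d) (n : ℕ) (u : Fin n → 𝒰) : Fin n → EuclideanSpace ℝ (Fin d) :=
  fun i => F.X (u i)

/-- The statistic `Z = n^{-1/2} ∑ i, X_i`. -/
def Z (F : RegularExpFamily ν d) (n : ℕ) (u : Fin n → 𝒰) : EuclideanSpace ℝ (Fin d) :=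
  (Real.sqrt n)⁻¹ • ∑ i, F.X (u i)

/-- `S` is (a version of) the RIPr e-variable at sample size `n`, for the alternative under which
the outcomes are i.i.d. with density `q`. -/
def IsRIP (F : RegularExpFamily ν d) (q : 𝒰 → ℝ≥0∞) (n : ℕ) (S : (Fin n → 𝒰) → ℝ≥0∞) : Prop :=
  IsRIPrEVar (Measure.pi fun _ => ν) (fun u => ∏ i, q (u i)) (F.nullN n) S

/-- `S` is (a version of) the seq-RIPr e-variable at sample size `n`; as the outcomes are i.i.d.
under the alternative, the conditional density given any past is `q`. -/
def IsSeqRIP (F : RegularExpFamily ν d) (q : 𝒰 → ℝ≥0∞) (n : ℕ) (S : (Fin n → 𝒰) → ℝ≥0∞) : Prop :=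
  IsSeqRIPrEVar ν (fun _ _ => q) F.null n S

/-- `S` is (a version of) the conditional e-variable `q(Uⁿ | Z) / p(Uⁿ | Z)`. -/
def IsCOND (F : RegularExpFamily ν d) (q : 𝒰 → ℝ≥0∞) (n : ℕ) (S : (Fin n → 𝒰) → ℝ≥0∞) : Prop :=
  IsCondLR (Measure.pi fun _ => ν) (Measure.pi fun _ => ν.withDensity q) (F.nullN n) (F.Z n) S

/-- `S` is (a version of) the ratio `q(Uⁿ | Xⁿ) / p(Uⁿ | Xⁿ)`. -/
def IsCondX (F : RegularExpFamily ν d) (q : 𝒰 → ℝ≥0∞) (n : ℕ) (S : (Fin n → 𝒰) → ℝ≥0∞) : Prop :=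
  IsCondLR (Measure.pi fun _ => ν) (Measure.pi fun _ => ν.withDensity q) (F.nullN n) (F.Xn n) S

end RegularExpFamily

end

end EVal

namespace EVal

noncomputable section

/-! ### Expected logarithms and Gibbs' inequality -/

section Logs

variable {Ω : Type*} [MeasurableSpace Ω] {μ : Measure Ω} {S T : Ω → ℝ≥0∞}

/-! Write `P` for the element with mean `μs` and `L = q / p_{μs}`, so that `Q = L·P`. Every other
element of the family has a `P`-density of the form `h(X)`. Since `X` has the same law under `Q` and
`P`, `E_P[L h(X)] = E_Q[h(X)] = E_P[h(X)] = 1`: `L` is an e-variable for the whole null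
(`lintegral_likelihoodRatio_eq`, `isEVariable_likelihoodRatio`).

Gibbs' inequality does the rest for the RIPr. Any `S` with `E_P[S] ≤ 1` has `E_Q[log S] ≤ E_Q[log L]
= D(Q‖P)`, so `L` is optimal; and as `L` has mean at most one under every mixture `P'` of the null,
`E_Q[log L] ≤ D(Q‖P')`, so `P` attains the infimum (`isRIPr_of_isEVariable`). When `D(Q‖P)` is
finite, the equality case of Gibbs' inequality gives uniqueness (`IsRIPr.ae_eq`). The argument
applies to `n` outcomes, with `Xⁿ` in place of `X`, and to each factor of the sequential product.

For a sufficient statistic `T` (`Z` or `Xⁿ`) whose law agrees under `Qⁿ` and `Pⁿ`, the marginal of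
`T` contributes no factor to the likelihood ratio, so conditioning on `T` leaves it unchanged
(`isCondLR_likelihoodRatio`, `IsCondLR.ae_eq`). The e-power then follows from additivity of the
logarithm, with infinite values handled in `expLog_pi_prod`. -/

lemma toENNReal_log {x : ℝ≥0∞} (h0 : x ≠ 0) (ht : x ≠ ∞) :
    (ENNReal.log x).toENNReal = ENNReal.ofReal (Real.log x.toReal) := by
  rw [ENNReal.log_pos_real h0 ht, EReal.real_coe_toENNReal]

lemma toENNReal_neg_log {x : ℝ≥0∞} (h0 : x ≠ 0) (ht : x ≠ ∞) :
    (-ENNReal.log x).toENNReal = ENNReal.ofReal (-Real.log x.toReal) := by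
  rw [ENNReal.log_pos_real h0 ht, ← EReal.coe_neg, EReal.real_coe_toENNReal]

lemma toENNReal_log_le (x : ℝ≥0∞) : (ENNReal.log x).toENNReal ≤ x := by
  rcases eq_or_ne x 0 with rfl | h0
  · simp
  rcases eq_or_ne x ∞ with rfl | ht
  · simp
  rw [toENNReal_log h0 ht]
  refine ENNReal.ofReal_le_of_le_toReal ?_
  have := Real.log_le_sub_one_of_pos (ENNReal.toReal_pos h0 ht)
  linarith

lemma expLog_congr (h : S =ᵐ[μ] T) : expLog μ S = expLog μ T := by
  unfold expLog
  congr 2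
  · exact lintegral_congr_ae (h.mono fun ω hω => by simp only [hω])
  · exact lintegral_congr_ae (h.mono fun ω hω => by simp only [hω])

lemma logExpDefined_congr (h : S =ᵐ[μ] T) : LogExpDefined μ S ↔ LogExpDefined μ T := by
  unfold LogExpDefined
  rw [lintegral_congr_ae (h.mono fun ω hω => by simp only [hω] :
      (fun ω => (ENNReal.log (S ω)).toENNReal) =ᵐ[μ] fun ω => (ENNReal.log (T ω)).toENNReal),
    lintegral_congr_ae (h.mono fun ω hω => by simp only [hω] :
      (fun ω => (-ENNReal.log (S ω)).toENNReal) =ᵐ[μ] fun ω => (-ENNReal.log (T ω)).toENNReal)]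

lemma expLog_ne_bot (h : ∫⁻ ω, (-(ENNReal.log (S ω))).toENNReal ∂μ ≠ ∞) : expLog μ S ≠ ⊥ := by
  unfold expLog
  rw [sub_eq_add_neg, ne_eq, EReal.add_eq_bot_iff]
  simp [h]

lemma expLog_ne_top (h : ∫⁻ ω, (ENNReal.log (S ω)).toENNReal ∂μ ≠ ∞) : expLog μ S ≠ ⊤ := by
  unfold expLog
  intro h'
  rw [sub_eq_add_neg] at h'
  refine (EReal.add_lt_top ?_ ?_).ne h'
  · simpa using h
  · simp

/-- Since `∞ - ∞` evaluates to `⊥`, an infinite negative part forces the value `⊥` whatever the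
positive part is. -/
lemma lintegral_ne_top_of_expLog_ne_bot (h : expLog μ S ≠ ⊥) :
    ∫⁻ ω, (-(ENNReal.log (S ω))).toENNReal ∂μ ≠ ∞ := by
  intro h'
  apply h
  simp [expLog, h']

lemma lintegral_ne_top_of_expLog_ne_top (h : expLog μ S ≠ ⊤) (hb : expLog μ S ≠ ⊥) :
    ∫⁻ ω, (ENNReal.log (S ω)).toENNReal ∂μ ≠ ∞ := by
  intro h'
  have := lintegral_ne_top_of_expLog_ne_bot hb
  apply h
  lift ∫⁻ ω, (-(ENNReal.log (S ω))).toENNReal ∂μ to ℝ≥0 using this with x hx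
  unfold expLog
  rw [← hx, h']
  exact EReal.top_sub_coe _

lemma expLog_eq_lintegral (h : ∀ᵐ ω ∂μ, S ω ≠ 0 ∧ S ω ≠ ∞) :
    expLog μ S = ((∫⁻ ω, ENNReal.ofReal (Real.log (S ω).toReal) ∂μ : ℝ≥0∞) : EReal)
      - ((∫⁻ ω, ENNReal.ofReal (-Real.log (S ω).toReal) ∂μ : ℝ≥0∞) : EReal) := by
  unfold expLog
  congr 2
  · exact lintegral_congr_ae (h.mono fun ω hω => toENNReal_log hω.1 hω.2)
  · exact lintegral_congr_ae (h.mono fun ω hω => toENNReal_neg_log hω.1 hω.2)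

lemma expLog_eq_integral (h : ∀ᵐ ω ∂μ, S ω ≠ 0 ∧ S ω ≠ ∞)
    (hi : Integrable (fun ω => Real.log (S ω).toReal) μ) :
    expLog μ S = ((∫ ω, Real.log (S ω).toReal ∂μ : ℝ) : EReal) := by
  have h1 : ∫⁻ ω, ENNReal.ofReal (Real.log (S ω).toReal) ∂μ ≠ ∞ := hi.lintegral_lt_top.ne
  have h2 : ∫⁻ ω, ENNReal.ofReal (-Real.log (S ω).toReal) ∂μ ≠ ∞ := hi.neg.lintegral_lt_top.ne
  rw [expLog_eq_lintegral h, integral_eq_lintegral_pos_part_sub_lintegral_neg_part hi,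
    EReal.coe_sub, EReal.coe_ennreal_toReal h1, EReal.coe_ennreal_toReal h2]

lemma ae_ne_zero_of_expLog_ne_bot (hS : Measurable S) (h : expLog μ S ≠ ⊥) :
    ∀ᵐ ω ∂μ, S ω ≠ 0 := by
  have hm : Measurable fun ω => (-(ENNReal.log (S ω))).toENNReal := by fun_prop
  filter_upwards [ae_lt_top hm (lintegral_ne_top_of_expLog_ne_bot h)] with ω hω h0
  simp [h0] at hω

lemma ae_ne_top_of_expLog_ne_top (hS : Measurable S) (h : expLog μ S ≠ ⊤) (hb : expLog μ S ≠ ⊥) :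
    ∀ᵐ ω ∂μ, S ω ≠ ∞ := by
  have hm : Measurable fun ω => (ENNReal.log (S ω)).toENNReal := by fun_prop
  filter_upwards [ae_lt_top hm (lintegral_ne_top_of_expLog_ne_top h hb)] with ω hω h0
  simp [h0] at hω

lemma integrable_log_of_expLog (hS : Measurable S) (hb : expLog μ S ≠ ⊥) (ht : expLog μ S ≠ ⊤) :
    Integrable (fun ω => Real.log (S ω).toReal) μ := by
  have h0 := ae_ne_zero_of_expLog_ne_bot hS hb
  have h1 := ae_ne_top_of_expLog_ne_top hS ht hb
  refine ⟨(Real.measurable_log.comp hS.ennreal_toReal).aestronglyMeasurable, ?_⟩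
  rw [hasFiniteIntegral_iff_norm]
  calc ∫⁻ ω, ENNReal.ofReal ‖Real.log (S ω).toReal‖ ∂μ
      ≤ ∫⁻ ω, ((ENNReal.log (S ω)).toENNReal + (-(ENNReal.log (S ω))).toENNReal) ∂μ := by
        refine lintegral_mono_ae ?_
        filter_upwards [h0, h1] with ω h0 h1
        rw [toENNReal_log h0 h1, toENNReal_neg_log h0 h1, Real.norm_eq_abs]
        rcases le_total 0 (Real.log (S ω).toReal) with h | h
        · rw [abs_of_nonneg h]; exact le_self_add
        · rw [abs_of_nonpos h]; exact le_add_self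
    _ = _ := lintegral_add_left (by fun_prop) _
    _ < ∞ := ENNReal.add_lt_top.2 ⟨(lintegral_ne_top_of_expLog_ne_top ht hb).lt_top,
        (lintegral_ne_top_of_expLog_ne_bot hb).lt_top⟩

end Logs

section Gibbs

variable {Ω : Type*} [MeasurableSpace Ω] {P : Measure Ω} {f S : Ω → ℝ≥0∞}

lemma ae_density_ne (hf : Measurable f) [IsFiniteMeasure (P.withDensity f)] :
    ∀ᵐ ω ∂(P.withDensity f), f ω ≠ 0 ∧ f ω ≠ ∞ := by
  have h : ∫⁻ ω, f ω ∂P ≠ ∞ := by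
    have := measure_ne_top (P.withDensity f) Set.univ
    rwa [withDensity_apply _ MeasurableSet.univ, setLIntegral_univ] at this
  rw [ae_withDensity_iff hf]
  filter_upwards [ae_lt_top hf h] with ω hω h0 using ⟨h0, hω.ne⟩

/-- Only an inequality, because `f * (S / f)` loses the mass of `S` where `f` is `0` or `∞`. -/
lemma lintegral_div_withDensity_le (hf : Measurable f) (hS : Measurable S) :
    ∫⁻ ω, S ω / f ω ∂(P.withDensity f) ≤ ∫⁻ ω, S ω ∂P := by
  have hm : Measurable fun ω => S ω / f ω := hS.div hf
  rw [lintegral_withDensity_eq_lintegral_mul _ hf hm]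
  exact lintegral_mono fun ω => ENNReal.mul_div_le

/-- The negative part of `log f` is the positive part of `log (1 / f)`, hence at most `1 / f`, whose
mean under `f·P` is at most `1`. Thus a divergence is never of the form `∞ - ∞`. -/
lemma lintegral_neg_log_density_ne_top [IsProbabilityMeasure P] (hf : Measurable f) :
    ∫⁻ ω, (-(ENNReal.log (f ω))).toENNReal ∂(P.withDensity f) ≠ ∞ := by
  refine ne_top_of_le_ne_top (b := 1) (by simp) ?_
  calc _ ≤ ∫⁻ ω, 1 / f ω ∂(P.withDensity f) := by
        refine lintegral_mono fun ω => ?_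
        rw [← ENNReal.log_inv, one_div]
        exact toENNReal_log_le _
    _ ≤ ∫⁻ ω, 1 ∂P := lintegral_div_withDensity_le hf measurable_const
    _ = 1 := by simp

/-- The expected log-likelihood ratio is the Kullback-Leibler divergence. -/
lemma expLog_withDensity_eq_klDiv [IsProbabilityMeasure P] (hf : Measurable f)
    [IsProbabilityMeasure (P.withDensity f)] :
    expLog (P.withDensity f) f = (InformationTheory.klDiv (P.withDensity f) P : EReal) := by
  have hac : P.withDensity f ≪ P := withDensity_absolutelyContinuous _ _
  have hne := ae_density_ne (P := P) hf
  have hll : llr (P.withDensity f) P =ᵐ[P.withDensity f] fun ω => Real.log (f ω).toReal := by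
    filter_upwards [hac.ae_le (Measure.rnDeriv_withDensity P hf)] with ω hω
    rw [llr, hω]
  have hb := expLog_ne_bot (lintegral_neg_log_density_ne_top (P := P) hf)
  -- The negative part being integrable, the value `⊤` occurs exactly when `llr` is not integrable,
  -- which is where `klDiv` is `∞` by definition.
  by_cases ht : expLog (P.withDensity f) f = ⊤
  · rw [ht, InformationTheory.klDiv_of_not_integrable, EReal.coe_ennreal_top]
    intro hi
    rw [integrable_congr hll] at hi
    rw [expLog_eq_integral hne hi] at ht
    exact EReal.coe_ne_top _ ht
  · have hi := integrable_log_of_expLog hf hb ht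
    have hi' : Integrable (llr (P.withDensity f) P) (P.withDensity f) := by
      rwa [integrable_congr hll]
    rw [expLog_eq_integral hne hi, ← integral_congr_ae hll,
      ← InformationTheory.toReal_klDiv_of_measure_eq hac (by simp),
      EReal.coe_ennreal_toReal (InformationTheory.klDiv_ne_top hac hi')]

/-- Splitting `log S = log (S / f) + log f` bounds the positive part of `log S` by `S / f` plus that
of `log f`; the first has mean at most `1`. -/
lemma expLog_ne_top_of_lintegral_le_one (hf : Measurable f)
    [IsProbabilityMeasure (P.withDensity f)] (hS : Measurable S) (h1 : ∫⁻ ω, S ω ∂P ≤ 1)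
    (hfin : ∫⁻ ω, (ENNReal.log (f ω)).toENNReal ∂(P.withDensity f) ≠ ∞) :
    expLog (P.withDensity f) S ≠ ⊤ := by
  refine expLog_ne_top (ne_top_of_le_ne_top (ENNReal.add_ne_top.2 ⟨?_, hfin⟩)
    (b := ∫⁻ ω, S ω / f ω ∂(P.withDensity f) + _) ?_)
  · exact ne_top_of_le_ne_top ENNReal.one_ne_top ((lintegral_div_withDensity_le hf hS).trans h1)
  · rw [← lintegral_add_left (by fun_prop)]
    refine lintegral_mono_ae ?_
    filter_upwards [ae_density_ne (P := P) hf] with ω hω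
    calc (ENNReal.log (S ω)).toENNReal = (ENNReal.log (S ω / f ω * f ω)).toENNReal := by
          rw [ENNReal.div_mul_cancel hω.1 hω.2]
      _ ≤ (ENNReal.log (S ω / f ω)).toENNReal + (ENNReal.log (f ω)).toENNReal := by
          rw [ENNReal.log_mul_add]; exact EReal.toENNReal_add_le
      _ ≤ _ := by gcongr; exact toENNReal_log_le _

/-- This is `log x ≤ x - 1` at `x = a / b`, strict unless `x = 1`; it is the integrand in the proof
of Gibbs' inequality. -/
lemma log_add_div_sub_one_nonneg {a b : ℝ≥0∞} (ha : a ≠ 0 ∧ a ≠ ∞) (hb : b ≠ 0 ∧ b ≠ ∞) :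
    0 ≤ Real.log b.toReal + (a / b).toReal - 1 - Real.log a.toReal ∧
    (Real.log b.toReal + (a / b).toReal - 1 - Real.log a.toReal = 0 → a = b) := by
  have ha' := ENNReal.toReal_pos ha.1 ha.2
  have hb' := ENNReal.toReal_pos hb.1 hb.2
  rw [ENNReal.toReal_div]
  have hlog : Real.log (a.toReal / b.toReal) = Real.log a.toReal - Real.log b.toReal :=
    Real.log_div ha'.ne' hb'.ne'
  constructor
  · have := Real.log_le_sub_one_of_pos (div_pos ha' hb')
    linarith
  · intro h
    by_contra hne
    have : a.toReal / b.toReal ≠ 1 := by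
      rw [ne_eq, div_eq_one_iff_eq hb'.ne']
      exact fun h => hne ((ENNReal.toReal_eq_toReal_iff' ha.2 hb.2).1 h)
    have := Real.log_lt_sub_one_of_pos (div_pos ha' hb') this
    linarith

/-- Gibbs' inequality, with its equality case, when all expectations are finite. -/
lemma gibbs_of_finite (hf : Measurable f) [IsProbabilityMeasure (P.withDensity f)]
    (hS : Measurable S) (h1 : ∫⁻ ω, S ω ∂P ≤ 1)
    (hfb : expLog (P.withDensity f) f ≠ ⊥) (hft : expLog (P.withDensity f) f ≠ ⊤)
    (hSb : expLog (P.withDensity f) S ≠ ⊥) :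
    expLog (P.withDensity f) S ≤ expLog (P.withDensity f) f ∧
    (expLog (P.withDensity f) f ≤ expLog (P.withDensity f) S → S =ᵐ[P.withDensity f] f) := by
  have hSt : expLog (P.withDensity f) S ≠ ⊤ := expLog_ne_top_of_lintegral_le_one hf hS h1
    (lintegral_ne_top_of_expLog_ne_top hft hfb)
  have hfne := ae_density_ne (P := P) hf
  have hSne : ∀ᵐ ω ∂(P.withDensity f), S ω ≠ 0 ∧ S ω ≠ ∞ :=
    (ae_ne_zero_of_expLog_ne_bot hS hSb).and (ae_ne_top_of_expLog_ne_top hS hSt hSb)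
  have hfi := integrable_log_of_expLog hf hfb hft
  have hSi := integrable_log_of_expLog hS hSb hSt
  have hle := (lintegral_div_withDensity_le (P := P) hf hS).trans h1
  have hri : Integrable (fun ω => (S ω / f ω).toReal) (P.withDensity f) :=
    integrable_toReal_of_lintegral_ne_top (by fun_prop) (ne_top_of_le_ne_top ENNReal.one_ne_top hle)
  have hr1 : ∫ ω, (S ω / f ω).toReal ∂(P.withDensity f) ≤ 1 := by
    rw [integral_toReal (by fun_prop)
      (ae_lt_top (by fun_prop) (ne_top_of_le_ne_top ENNReal.one_ne_top hle))]
    exact ENNReal.toReal_le_of_le_ofReal zero_le_one (by simpa using hle)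
  -- `g` is nonnegative, and its integral is at most the gap between the two expected logarithms
  -- because `S / f` has mean at most `1`. A nonpositive gap therefore forces `g = 0`, that is `S =
  -- f`, almost everywhere.
  set g : Ω → ℝ := fun ω =>
    Real.log (f ω).toReal + (S ω / f ω).toReal - 1 - Real.log (S ω).toReal with hg
  have hgi : Integrable g (P.withDensity f) :=
    ((hfi.add hri).sub (integrable_const 1)).sub hSi
  have hg0 : 0 ≤ᵐ[P.withDensity f] g := by
    filter_upwards [hfne, hSne] with ω h h' using (log_add_div_sub_one_nonneg h' h).1
  have hgint : ∫ ω, g ω ∂(P.withDensity f) = ∫ ω, Real.log (f ω).toReal ∂(P.withDensity f)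
      + ∫ ω, (S ω / f ω).toReal ∂(P.withDensity f) - 1
      - ∫ ω, Real.log (S ω).toReal ∂(P.withDensity f) := by
    have hg' : g = ((fun ω => Real.log (f ω).toReal) + (fun ω => (S ω / f ω).toReal)
        - fun _ => (1 : ℝ)) - fun ω => Real.log (S ω).toReal := rfl
    rw [hg', integral_sub' ((hfi.add hri).sub (integrable_const 1)) hSi,
      integral_sub' (hfi.add hri) (integrable_const 1), integral_add' hfi hri]
    simp
  have hgn := integral_nonneg_of_ae hg0
  rw [expLog_eq_integral hfne hfi, expLog_eq_integral hSne hSi, EReal.coe_le_coe_iff,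
    EReal.coe_le_coe_iff]
  refine ⟨by linarith, fun h => ?_⟩
  have hz : ∫ ω, g ω ∂(P.withDensity f) = 0 := by linarith
  rw [integral_eq_zero_iff_of_nonneg_ae hg0 hgi] at hz
  filter_upwards [hz, hfne, hSne] with ω hz h h' using (log_add_div_sub_one_nonneg h' h).2 hz

lemma expLog_le_expLog_density [IsProbabilityMeasure P] (hf : Measurable f)
    [IsProbabilityMeasure (P.withDensity f)] (hS : Measurable S) (h1 : ∫⁻ ω, S ω ∂P ≤ 1) :
    expLog (P.withDensity f) S ≤ expLog (P.withDensity f) f := by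
  by_cases hft : expLog (P.withDensity f) f = ⊤
  · rw [hft]; exact le_top
  by_cases hSb : expLog (P.withDensity f) S = ⊥
  · rw [hSb]; exact bot_le
  exact (gibbs_of_finite hf hS h1 (expLog_ne_bot (lintegral_neg_log_density_ne_top hf)) hft hSb).1

lemma ae_eq_density_of_expLog_le [IsProbabilityMeasure P] (hf : Measurable f)
    [IsProbabilityMeasure (P.withDensity f)] (hS : Measurable S) (h1 : ∫⁻ ω, S ω ∂P ≤ 1)
    (hft : expLog (P.withDensity f) f ≠ ⊤)
    (h : expLog (P.withDensity f) f ≤ expLog (P.withDensity f) S) : S =ᵐ[P.withDensity f] f := by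
  have hfb := expLog_ne_bot (lintegral_neg_log_density_ne_top (P := P) hf)
  exact (gibbs_of_finite hf hS h1 hfb hft (ne_bot_of_le_ne_bot hfb h)).2 h

/-- Gibbs' inequality with `f = dQ/dP`; without absolute continuity the divergence is `∞`. It
provides the lower bound on divergences from mixtures of the null. -/
lemma expLog_le_klDiv {Q : Measure Ω} [IsProbabilityMeasure P] [IsProbabilityMeasure Q]
    (hS : Measurable S) (h1 : ∫⁻ ω, S ω ∂P ≤ 1) :
    expLog Q S ≤ (InformationTheory.klDiv Q P : EReal) := by
  by_cases hac : Q ≪ P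
  · have hQ := Measure.withDensity_rnDeriv_eq Q P hac
    have : IsProbabilityMeasure (P.withDensity (Q.rnDeriv P)) := by rw [hQ]; infer_instance
    have h := expLog_le_expLog_density (Measure.measurable_rnDeriv Q P) hS h1
    rwa [expLog_withDensity_eq_klDiv (Measure.measurable_rnDeriv Q P), hQ] at h
  · rw [InformationTheory.klDiv_of_not_ac hac, EReal.coe_ennreal_top]
    exact le_top

end Gibbs

/-! ### Finite product measures -/

section Products

variable {𝒰 : Type*} [MeasurableSpace 𝒰] {n : ℕ}

lemma lintegral_pi_prod {n : ℕ} (μ : Fin n → Measure 𝒰) [∀ i, SigmaFinite (μ i)]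
    (f : Fin n → 𝒰 → ℝ≥0∞) (hf : ∀ i, Measurable (f i)) :
    ∫⁻ u, ∏ i, f i (u i) ∂(Measure.pi μ) = ∏ i, ∫⁻ x, f i x ∂(μ i) := by
  induction n with
  | zero => simp
  | succ n ih =>
    have hm : Measurable fun w : Fin n → 𝒰 => ∏ i : Fin n, f i.succ (w i) :=
      Finset.measurable_prod _ fun i _ => (hf _).comp (measurable_pi_apply i)
    have key := (measurePreserving_piFinSuccAbove (α := fun _ => 𝒰) μ 0).lintegral_comp
      (f := fun z => f 0 z.1 * ∏ i : Fin n, f i.succ (z.2 i))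
      (((hf 0).comp measurable_fst).mul (hm.comp measurable_snd))
    rw [lintegral_prod_mul (hf 0).aemeasurable hm.aemeasurable] at key
    simp only [Fin.zero_succAbove] at key
    rw [ih (fun j => μ j.succ) _ fun i => hf _] at key
    rw [Fin.prod_univ_succ, ← key]
    refine lintegral_congr fun u => ?_
    rw [Fin.prod_univ_succ]
    rfl

lemma measurable_prod_apply {f : 𝒰 → ℝ≥0∞} (hf : Measurable f) :
    Measurable fun u : Fin n → 𝒰 => ∏ i, f (u i) :=
  Finset.measurable_prod _ fun i _ => hf.comp (measurable_pi_apply i)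

lemma pi_withDensity (ν : Measure 𝒰) [SigmaFinite ν] {f : 𝒰 → ℝ≥0∞} (hf : Measurable f)
    [SigmaFinite (ν.withDensity f)] :
    (Measure.pi fun _ : Fin n => ν.withDensity f)
      = (Measure.pi fun _ : Fin n => ν).withDensity fun u => ∏ i, f (u i) := by
  refine Measure.pi_eq fun s hs => ?_
  rw [withDensity_apply _ (MeasurableSet.univ_pi hs), Measure.restrict_pi_pi,
    lintegral_pi_prod _ (fun _ => f) fun _ => hf]
  exact Finset.prod_congr rfl fun i _ => (withDensity_apply _ (hs i)).symm

lemma pi_absolutelyContinuous {μ ν : Measure 𝒰} [SigmaFinite μ] [SigmaFinite ν] (h : μ ≪ ν) :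
    (Measure.pi fun _ : Fin n => μ) ≪ Measure.pi fun _ : Fin n => ν := by
  have hμ := Measure.withDensity_rnDeriv_eq μ ν h
  have : SigmaFinite (ν.withDensity (μ.rnDeriv ν)) := by rw [hμ]; infer_instance
  have key := pi_withDensity (n := n) ν (Measure.measurable_rnDeriv μ ν)
  rw [hμ] at key
  rw [key]
  exact withDensity_absolutelyContinuous _ _

lemma ae_pi_of_ae {ν : Measure 𝒰} [SigmaFinite ν] {p : 𝒰 → Prop} (h : ∀ᵐ x ∂ν, p x) :
    ∀ᵐ u ∂(Measure.pi fun _ : Fin n => ν), ∀ i, p (u i) :=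
  eventually_all.2 fun i => (Measure.quasiMeasurePreserving_eval (fun _ => ν) i).ae h

lemma prod_div_prod {q p : Fin n → ℝ≥0∞} (hp : ∀ i, p i ≠ 0 ∧ p i ≠ ∞) :
    (∏ i, q i) / ∏ i, p i = ∏ i, q i / p i := by
  simp only [div_eq_mul_inv, Finset.prod_mul_distrib]
  rw [ENNReal.prod_inv_distrib]
  intro i _ j _ _
  exact Or.inl (hp i).1

/-- If a property of an outcome holds almost surely given every past, then it holds almost surely
along the sequence of outcomes. -/
lemma ae_past {ν : Measure 𝒰} [SigmaFinite ν] (i : Fin n) {s : Set ((Fin (i : ℕ) → 𝒰) × 𝒰)}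
    (hs : MeasurableSet s) (h : ∀ v, ∀ᵐ x ∂ν, (v, x) ∈ s) :
    ∀ᵐ u ∂(Measure.pi fun _ : Fin n => ν), (past u i, u i) ∈ s := by
  cases n with
  | zero => exact i.elim0
  | succ n =>
    have hpast : Measurable fun u : Fin (n + 1) → 𝒰 => (past u i, u i) :=
      (measurable_pi_lambda _ fun j => measurable_pi_apply _).prodMk (measurable_pi_apply i)
    set e := MeasurableEquiv.piFinSuccAbove (fun _ : Fin (n + 1) => 𝒰) i with he
    have hmp := measurePreserving_piFinSuccAbove (α := fun _ => 𝒰) (fun _ => ν) i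
    let t : Set (𝒰 × (Fin n → 𝒰)) := {z | (past (e.symm z) i, e.symm z i) ∉ s}
    have ht : MeasurableSet t := (hpast.comp e.symm.measurable) hs.compl
    have h0 : (ν.prod (Measure.pi fun _ : Fin n => ν)) t = 0 := by
      rw [Measure.prod_apply_symm ht, lintegral_eq_zero_iff (measurable_measure_prodMk_right ht)]
      refine Eventually.of_forall fun w => ?_
      -- Fubini with coordinate `i` integrated first: inserting `x` at position `i` does not move
      -- the entries of smaller index, so the past depends on `w` alone and `h` applies to each
      -- slice.
      have hw : ∀ x, (past (e.symm (x, w)) i, e.symm (x, w) i)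
          = ((fun j : Fin (i : ℕ) => w ⟨j, by omega⟩ : Fin (i : ℕ) → 𝒰), x) := by
        intro x
        refine Prod.ext ?_ ?_
        · funext j
          change i.insertNth (α := fun _ => 𝒰) x w ⟨j, _⟩ = _
          have hj : (⟨j, j.2.trans i.2⟩ : Fin (n + 1)) = i.succAbove ⟨j, by omega⟩ := by
            rw [Fin.succAbove_of_castSucc_lt _ _ (by simp [Fin.lt_def])]
            rfl
          rw [hj, Fin.insertNth_apply_succAbove]
        · change i.insertNth (α := fun _ => 𝒰) x w i = x
          simp
      change ν {x | (past (e.symm (x, w)) i, e.symm (x, w) i) ∉ s} = 0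
      simp only [hw]
      exact h _
    have := hmp.preimage_null h0
    rw [ae_iff]
    refine measure_mono_null (fun u hu => ?_) this
    change (past (e.symm (e u)) i, e.symm (e u) i) ∉ s
    rw [e.symm_apply_apply]
    exact hu

/-- Decomposing a sum and its terms into positive and negative parts, with subtractions moved across
so that the identity can be integrated in `ℝ≥0∞` even when some integrals are infinite. -/
lemma ofReal_sum_add_sum_ofReal_neg (g : Fin n → ℝ) :
    ENNReal.ofReal (∑ i, g i) + ∑ i, ENNReal.ofReal (-g i)
      = ENNReal.ofReal (-∑ i, g i) + ∑ i, ENNReal.ofReal (g i) := by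
  have h : ∀ x, ENNReal.ofReal x = ENNReal.ofReal (max x 0) := fun x => by
    rcases le_total 0 x with hx | hx <;> simp [hx, ENNReal.ofReal_of_nonpos]
  simp only [h (-g _), h (g _), h (∑ i, g i), h (-∑ i, g i)]
  rw [← ENNReal.ofReal_sum_of_nonneg fun _ _ => le_max_right _ _,
    ← ENNReal.ofReal_sum_of_nonneg fun _ _ => le_max_right _ _,
    ← ENNReal.ofReal_add (le_max_right _ _) (Finset.sum_nonneg fun _ _ => le_max_right _ _),
    ← ENNReal.ofReal_add (le_max_right _ _) (Finset.sum_nonneg fun _ _ => le_max_right _ _)]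
  congr 1
  have h1 := max_zero_sub_max_neg_zero_eq_self (∑ i, g i)
  have h2 : ∑ i, max (g i) 0 - ∑ i, max (-g i) 0 = ∑ i, g i := by
    rw [← Finset.sum_sub_distrib]
    exact Finset.sum_congr rfl fun i _ => max_zero_sub_max_neg_zero_eq_self _
  linarith

lemma ofReal_sum_le (g : Fin n → ℝ) :
    ENNReal.ofReal (∑ i, g i) ≤ ∑ i, ENNReal.ofReal (g i) := by
  refine Finset.le_sum_of_subadditive _ ENNReal.ofReal_zero.le ?_ _ _
  exact fun _ _ => ENNReal.ofReal_add_le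

/-- Here `A`, `B` stand for the integrated positive and negative parts of the log of the product,
and `a`, `b` for those of one outcome. If one of `a`, `b` is infinite, the balance equation forces
the corresponding one of `A`, `B` to be infinite, while the bounds keep the other finite. -/
lemma sub_eq_nat_mul_sub {A B a b : ℝ≥0∞} (hn : 1 ≤ n) (h : A + n * b = B + n * a)
    (hA : A ≤ n * a) (hB : B ≤ n * b) (hab : a ≠ ∞ ∨ b ≠ ∞) :
    (A ≠ ∞ ∨ B ≠ ∞) ∧ (A : EReal) - (B : EReal) = (n : EReal) * ((a : EReal) - (b : EReal)) := by
  have hn0 : (n : ℝ≥0∞) ≠ 0 := by exact_mod_cast (by omega : n ≠ 0)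
  have hnt : (n : ℝ≥0∞) ≠ ∞ := ENNReal.natCast_ne_top n
  have hnpos : (0 : EReal) < n := by exact_mod_cast hn
  by_cases ha : a = ∞
  · have hb : b ≠ ∞ := by tauto
    have hB' : B ≠ ∞ := ne_top_of_le_ne_top (ENNReal.mul_ne_top hnt hb) hB
    have hA' : A = ∞ := by
      rw [ha, ENNReal.mul_top hn0, add_top, ENNReal.add_eq_top] at h
      exact h.resolve_right (ENNReal.mul_ne_top hnt hb)
    refine ⟨Or.inr hB', ?_⟩
    lift b to ℝ≥0 using hb
    lift B to ℝ≥0 using hB'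
    rw [hA', ha]
    change (⊤ : EReal) - ((B : ℝ) : EReal) = n * ((⊤ : EReal) - ((b : ℝ) : EReal))
    rw [EReal.top_sub_coe, EReal.top_sub_coe, EReal.mul_top_of_pos hnpos]
  · have hA' : A ≠ ∞ := ne_top_of_le_ne_top (ENNReal.mul_ne_top hnt ha) hA
    refine ⟨Or.inl hA', ?_⟩
    by_cases hb : b = ∞
    · have hB' : B = ∞ := by
        rw [hb, ENNReal.mul_top hn0, add_top, eq_comm, ENNReal.add_eq_top] at h
        exact h.resolve_right (ENNReal.mul_ne_top hnt ha)
      rw [hB', hb]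
      simp [EReal.mul_bot_of_pos hnpos]
    · have hB' : B ≠ ∞ := ne_top_of_le_ne_top (ENNReal.mul_ne_top hnt hb) hB
      lift a to ℝ≥0 using ha
      lift b to ℝ≥0 using hb
      lift A to ℝ≥0 using hA'
      lift B to ℝ≥0 using hB'
      have h' : (A : ℝ) + n * b = B + n * a := by exact_mod_cast h
      change ((A : ℝ) : EReal) - ((B : ℝ) : EReal)
        = ((n : ℝ) : EReal) * (((a : ℝ) : EReal) - ((b : ℝ) : EReal))
      rw [← EReal.coe_sub, ← EReal.coe_sub, ← EReal.coe_mul]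
      congr 1
      linarith

lemma lintegral_pi_sum {ρ : Measure 𝒰} [IsProbabilityMeasure ρ] {f : 𝒰 → ℝ≥0∞}
    (hf : Measurable f) :
    ∫⁻ u, ∑ i, f (u i) ∂(Measure.pi fun _ : Fin n => ρ) = n * ∫⁻ x, f x ∂ρ := by
  have hm : ∀ i : Fin n, Measurable fun u : Fin n → 𝒰 => f (u i) :=
    fun i => hf.comp (measurable_pi_apply i)
  rw [lintegral_finsetSum _ fun i _ => hm i]
  simp_rw [fun i : Fin n => (measurePreserving_eval (fun _ => ρ) i).lintegral_comp hf]
  simp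

/-- Expected logarithms are additive over i.i.d. outcomes. -/
lemma expLog_pi_prod {ρ : Measure 𝒰} [IsProbabilityMeasure ρ] (hn : 1 ≤ n) {s : 𝒰 → ℝ≥0∞}
    (hs : Measurable s) (hne : ∀ᵐ x ∂ρ, s x ≠ 0 ∧ s x ≠ ∞) (hdef : LogExpDefined ρ s) :
    LogExpDefined (Measure.pi fun _ : Fin n => ρ) (fun u => ∏ i, s (u i)) ∧
    expLog (Measure.pi fun _ : Fin n => ρ) (fun u => ∏ i, s (u i)) = n * expLog ρ s := by
  have hne' := ae_pi_of_ae (n := n) hne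
  let g : 𝒰 → ℝ := fun x => Real.log (s x).toReal
  have hg : Measurable g := Real.measurable_log.comp hs.ennreal_toReal
  have hgn : Measurable fun u : Fin n → 𝒰 => ∑ i, g (u i) :=
    Finset.measurable_sum _ fun i _ => hg.comp (measurable_pi_apply i)
  have hgneg : Measurable fun x => -g x := hg.neg
  have hgnneg : Measurable fun u : Fin n → 𝒰 => -∑ i, g (u i) := hgn.neg
  have hsum : ∀ᵐ u ∂(Measure.pi fun _ : Fin n => ρ), (∏ i, s (u i) ≠ 0 ∧ ∏ i, s (u i) ≠ ∞) ∧
      Real.log (∏ i, s (u i)).toReal = ∑ i, g (u i) := by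
    filter_upwards [hne'] with u hu
    refine ⟨⟨Finset.prod_ne_zero_iff.2 fun i _ => (hu i).1,
      ENNReal.prod_ne_top fun i _ => (hu i).2⟩, ?_⟩
    rw [ENNReal.toReal_prod, Real.log_prod fun i _ => (ENNReal.toReal_pos (hu i).1 (hu i).2).ne']
  have e1 : ∫⁻ u, (ENNReal.log (∏ i, s (u i))).toENNReal ∂(Measure.pi fun _ : Fin n => ρ)
      = ∫⁻ u, ENNReal.ofReal (∑ i, g (u i)) ∂(Measure.pi fun _ : Fin n => ρ) := by
    refine lintegral_congr_ae (hsum.mono fun u hu => ?_)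
    simp only
    rw [toENNReal_log hu.1.1 hu.1.2, hu.2]
  have e2 : ∫⁻ u, (-ENNReal.log (∏ i, s (u i))).toENNReal ∂(Measure.pi fun _ : Fin n => ρ)
      = ∫⁻ u, ENNReal.ofReal (-∑ i, g (u i)) ∂(Measure.pi fun _ : Fin n => ρ) := by
    refine lintegral_congr_ae (hsum.mono fun u hu => ?_)
    simp only
    rw [toENNReal_neg_log hu.1.1 hu.1.2, hu.2]
  have e3 : ∫⁻ x, (ENNReal.log (s x)).toENNReal ∂ρ = ∫⁻ x, ENNReal.ofReal (g x) ∂ρ :=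
    lintegral_congr_ae (hne.mono fun u hu => toENNReal_log hu.1 hu.2)
  have e4 : ∫⁻ x, (-ENNReal.log (s x)).toENNReal ∂ρ = ∫⁻ x, ENNReal.ofReal (-g x) ∂ρ :=
    lintegral_congr_ae (hne.mono fun u hu => toENNReal_neg_log hu.1 hu.2)
  unfold LogExpDefined at hdef ⊢
  unfold expLog
  rw [e3, e4] at hdef
  rw [e1, e2, e3, e4]
  refine sub_eq_nat_mul_sub hn ?_ ?_ ?_ hdef
  · rw [← lintegral_pi_sum hgneg.ennreal_ofReal, ← lintegral_pi_sum hg.ennreal_ofReal,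
      ← lintegral_add_left hgn.ennreal_ofReal, ← lintegral_add_left hgnneg.ennreal_ofReal]
    exact lintegral_congr fun u => ofReal_sum_add_sum_ofReal_neg fun i => g (u i)
  · rw [← lintegral_pi_sum hg.ennreal_ofReal]
    exact lintegral_mono fun u => ofReal_sum_le fun i => g (u i)
  · rw [← lintegral_pi_sum hgneg.ennreal_ofReal]
    refine lintegral_mono fun u => ?_
    rw [← Finset.sum_neg_distrib]
    exact ofReal_sum_le fun i => -g (u i)

end Products

/-! ### Reverse information projections onto an element of the null -/

section RIPr

variable {Ω : Type*} [MeasurableSpace Ω] {ν : Measure Ω} {p q : Ω → ℝ≥0∞} {C : Set (Measure Ω)}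

lemma withDensity_eq_withDensity_div (hp : Measurable p) (hq : Measurable q)
    (hne : ∀ᵐ ω ∂ν, p ω ≠ 0 ∧ p ω ≠ ∞) :
    ν.withDensity q = (ν.withDensity p).withDensity fun ω => q ω / p ω := by
  have hm : Measurable fun ω => q ω / p ω := hq.div hp
  rw [← withDensity_mul _ hp hm]
  refine withDensity_congr_ae ?_
  filter_upwards [hne] with ω hω
  exact (ENNReal.mul_div_cancel hω.1 hω.2).symm

lemma isProbabilityMeasure_of_mem_convexHull (hC : ∀ P ∈ C, IsProbabilityMeasure P)
    {P : Measure Ω} (hP : P ∈ convexHull ℝ≥0 C) : IsProbabilityMeasure P := by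
  have hconv : Convex ℝ≥0 {P : Measure Ω | IsProbabilityMeasure P} := by
    intro P hP Q hQ a b _ _ hab
    have hP' : IsProbabilityMeasure P := hP
    have hQ' : IsProbabilityMeasure Q := hQ
    refine ⟨?_⟩
    simp only [Measure.coe_add, Measure.coe_nnreal_smul_apply, Pi.add_apply, measure_univ, mul_one]
    exact_mod_cast hab
  exact convexHull_min hC hconv hP

lemma IsEVariable.lintegral_le_of_mem_convexHull {S : Ω → ℝ≥0∞} (hS : IsEVariable C S)
    {P : Measure Ω} (hP : P ∈ convexHull ℝ≥0 C) : ∫⁻ ω, S ω ∂P ≤ 1 := by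
  have hconv : Convex ℝ≥0 {P : Measure Ω | ∫⁻ ω, S ω ∂P ≤ 1} := by
    intro P hP Q hQ a b _ _ hab
    simp only [Set.mem_ofPred_eq] at hP hQ ⊢
    rw [lintegral_add_measure, lintegral_smul_measure, lintegral_smul_measure]
    calc a • ∫⁻ ω, S ω ∂P + b • ∫⁻ ω, S ω ∂Q ≤ a • (1 : ℝ≥0∞) + b • (1 : ℝ≥0∞) := by gcongr
      _ = 1 := by rw [← add_smul, hab, one_smul]
  exact convexHull_min hS.2 hconv hP

/-- If the likelihood ratio of `Q` and an element of the null is an e-variable, then the density of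
this element is the RIPr. -/
lemma isRIPr_of_isEVariable (hp : Measurable p) (hq : Measurable q)
    (hne : ∀ᵐ ω ∂ν, p ω ≠ 0 ∧ p ω ≠ ∞) (hC : ∀ P ∈ C, IsProbabilityMeasure P)
    [IsProbabilityMeasure (ν.withDensity q)] (hpC : ν.withDensity p ∈ C)
    (hE : IsEVariable C fun ω => q ω / p ω) : IsRIPr ν q C p := by
  have : IsProbabilityMeasure (ν.withDensity p) := hC _ hpC
  have hQ := withDensity_eq_withDensity_div hp hq hne
  have : IsProbabilityMeasure ((ν.withDensity p).withDensity fun ω => q ω / p ω) := by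
    rw [← hQ]; infer_instance
  have hkl := expLog_withDensity_eq_klDiv (P := ν.withDensity p) hE.1
  refine ⟨hp, ?_, ?_, hE, fun S hS => ?_⟩
  · rw [← setLIntegral_univ, ← withDensity_apply _ MeasurableSet.univ]
    exact prob_le_one
  · refine le_antisymm ?_ ?_
    · have hle : (expLog (ν.withDensity q) fun ω => q ω / p ω).toENNReal ≤
          ⨅ P ∈ convexHull ℝ≥0 C, InformationTheory.klDiv (ν.withDensity q) P := by
        refine le_iInf₂ fun P hP => ?_
        have := isProbabilityMeasure_of_mem_convexHull hC hP
        have h := EReal.toENNReal_le_toENNReal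
          (expLog_le_klDiv (Q := ν.withDensity q) hE.1 (hE.lintegral_le_of_mem_convexHull hP))
        rwa [EReal.toENNReal_coe] at h
      refine le_trans ?_ (EReal.coe_ennreal_le_coe_ennreal_iff.2 hle)
      rw [EReal.coe_toENNReal_eq_max]
      exact le_max_right _ _
    · rw [← hQ] at hkl
      rw [hkl]
      exact EReal.coe_ennreal_le_coe_ennreal_iff.2 (iInf₂_le _ (subset_convexHull _ _ hpC))
  · rw [hQ]
    exact expLog_le_expLog_density hE.1 hS.1 (hS.2 _ hpC)

/-- Essential uniqueness of the RIPr. -/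
lemma IsRIPr.ae_eq (hp : Measurable p) (hq : Measurable q)
    (hne : ∀ᵐ ω ∂ν, p ω ≠ 0 ∧ p ω ≠ ∞) (hC : ∀ P ∈ C, IsProbabilityMeasure P)
    [IsProbabilityMeasure (ν.withDensity q)] (hνQ : ν ≪ ν.withDensity q)
    (hpC : ν.withDensity p ∈ C)
    (hE : IsEVariable C fun ω => q ω / p ω)
    (hfin : expLog (ν.withDensity q) (fun ω => q ω / p ω) ≠ ⊤)
    {r : Ω → ℝ≥0∞} (hr : IsRIPr ν q C r) :
    (fun ω => q ω / r ω) =ᵐ[ν] fun ω => q ω / p ω := by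
  have : IsProbabilityMeasure (ν.withDensity p) := hC _ hpC
  have hQ := withDensity_eq_withDensity_div hp hq hne
  have : IsProbabilityMeasure ((ν.withDensity p).withDensity fun ω => q ω / p ω) := by
    rw [← hQ]; infer_instance
  -- Optimality of `q / r` against the e-variable `q / p` is the reverse of Gibbs' inequality, so
  -- its equality case applies.
  have hopt := hr.optimal _ hE
  have hE' := hr.eVariable
  rw [hQ] at hfin hopt
  refine hνQ.ae_le ?_
  rw [hQ]
  exact ae_eq_density_of_expLog_le hE.1 hE'.1 (hE'.2 _ hpC) hfin hopt

/-- The likelihood ratio integrates like the constant `1` under a density that is a function of a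
statistic with the same distribution under the numerator and the denominator. -/
lemma lintegral_likelihoodRatio_eq {𝒯 : Type*} [MeasurableSpace 𝒯] {P : Measure Ω} {L : Ω → ℝ≥0∞}
    (hL : Measurable L) {T : Ω → 𝒯} (hT : Measurable T) (hmap : (P.withDensity L).map T = P.map T)
    {h : 𝒯 → ℝ≥0∞} (hh : Measurable h) :
    ∫⁻ ω, L ω ∂(P.withDensity fun ω => h (T ω)) = (P.withDensity fun ω => h (T ω)) Set.univ := by
  have hhT : Measurable fun ω => h (T ω) := hh.comp hT
  -- With `Q = L·P`, the chain is `E_P[h(T) L] = E_Q[h(T)] = E_P[h(T)]`, the laws of `T` being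
  -- equal.
  rw [lintegral_withDensity_eq_lintegral_mul _ hhT hL, mul_comm,
    ← lintegral_withDensity_eq_lintegral_mul _ hL hhT, ← lintegral_map hh hT, hmap,
    lintegral_map hh hT, withDensity_apply _ MeasurableSet.univ, setLIntegral_univ]

end RIPr

/-! ### Conditional likelihood ratios -/

section Conditional

variable {Ω 𝒯 : Type*} [MeasurableSpace Ω] [MeasurableSpace 𝒯]

lemma map_withDensity_comp {α β : Type*} [MeasurableSpace α] [MeasurableSpace β] (μ : Measure α)
    {f : α → β} (hf : Measurable f) {g : β → ℝ≥0∞} (hg : Measurable g) :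
    (μ.withDensity fun a => g (f a)).map f = (μ.map f).withDensity g := by
  ext s hs
  rw [Measure.map_apply hf hs, withDensity_apply _ (hf hs), withDensity_apply _ hs,
    setLIntegral_map hs hg hf]

lemma compProd_withDensity_fst (m : Measure 𝒯) [SFinite m] (κ : Kernel 𝒯 Ω) [IsSFiniteKernel κ]
    {h : 𝒯 → ℝ≥0∞} (hh : Measurable h) [SFinite (m.withDensity h)] :
    (m.withDensity h) ⊗ₘ κ = (m ⊗ₘ κ).withDensity fun x => h x.1 := by
  have hh1 : Measurable fun x : 𝒯 × Ω => h x.1 := hh.comp measurable_fst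
  ext s hs
  rw [Measure.compProd_apply hs, withDensity_apply _ hs, ← lintegral_indicator hs,
    Measure.lintegral_compProd (hh1.indicator hs),
    lintegral_withDensity_eq_lintegral_mul _ hh (Kernel.measurable_kernel_prodMk_left hs)]
  refine lintegral_congr fun z => ?_
  have hz : MeasurableSet (Prod.mk z ⁻¹' s) := measurable_prodMk_left hs
  have : (fun ω => s.indicator (fun x : 𝒯 × Ω => h x.1) (z, ω))
      = (Prod.mk z ⁻¹' s).indicator fun _ => h z := rfl
  rw [this, lintegral_indicator_const hz, Pi.mul_apply]

/-- Regular conditional distributions given `T` do not change when the density is multiplied by a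
function of `T`. -/
lemma IsRegCondDistrib.withDensity_comp {P : Measure Ω} [IsFiniteMeasure P] {T : Ω → 𝒯}
    (hT : Measurable T) {κ : Kernel 𝒯 Ω} (hκ : IsRegCondDistrib P T κ) {h : 𝒯 → ℝ≥0∞}
    (hh : Measurable h) : IsRegCondDistrib (P.withDensity fun ω => h (T ω)) T κ := by
  have := hκ.1
  refine ⟨hκ.1, ?_⟩
  have key := map_withDensity_comp P (f := fun ω => (T ω, ω)) (hT.prodMk measurable_id)
    (g := fun x => h x.1) (hh.comp measurable_fst)
  rw [key, map_withDensity_comp P hT hh, hκ.2, compProd_withDensity_fst _ _ hh]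

variable {P Q : Measure Ω} [IsProbabilityMeasure P] {L : Ω → ℝ≥0∞}
  {T : Ω → 𝒯} {κP κQ : Kernel 𝒯 Ω}

/-- The joint law of `(T, ω)` under `Q` has density `L(ω)` relative to that under `P`. Both
disintegrate over the same law of `T`, so integrating over `B × Ω` for all `B` identifies the fibre
integrals. The exceptional null set may depend on `f`. -/
lemma ae_lintegral_kernel_eq (hL : Measurable L) (hQ : Q = P.withDensity L) (hT : Measurable T)
    (hmap : Q.map T = P.map T) (hP : IsRegCondDistrib P T κP) (hκQ : IsRegCondDistrib Q T κQ)
    {f : 𝒯 × Ω → ℝ≥0∞} (hf : Measurable f) :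
    ∀ᵐ z ∂(P.map T), ∫⁻ ω, f (z, ω) ∂(κQ z) = ∫⁻ ω, L ω * f (z, ω) ∂(κP z) := by
  have := hP.1
  have := hκQ.1
  have : IsProbabilityMeasure (P.map T) := Measure.isProbabilityMeasure_map hT.aemeasurable
  have hLs : Measurable fun x : 𝒯 × Ω => L x.2 := hL.comp measurable_snd
  have hM : P.map T ⊗ₘ κQ = (P.map T ⊗ₘ κP).withDensity fun x => L x.2 := by
    rw [← hP.2, ← hmap, ← hκQ.2, hQ]
    exact map_withDensity_comp P (f := fun ω => (T ω, ω)) (hT.prodMk measurable_id)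
      (g := fun x => L x.2) hLs
  refine ae_eq_of_forall_setLIntegral_eq_of_sigmaFinite hf.lintegral_kernel_prod_right'
    (hLs.mul hf).lintegral_kernel_prod_right' fun B hB _ => ?_
  have h1 := Measure.setLIntegral_compProd (μ := P.map T) (κ := κQ) hf hB MeasurableSet.univ
  have h2 := Measure.setLIntegral_compProd (μ := P.map T) (κ := κP) (hLs.mul hf) hB
    MeasurableSet.univ
  simp only [Measure.restrict_univ] at h1 h2
  change _ = ∫⁻ z in B, ∫⁻ ω, ((fun x : 𝒯 × Ω => L x.2) * f) (z, ω) ∂(κP z) ∂(P.map T)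
  rw [← h1, ← h2, hM, setLIntegral_withDensity_eq_setLIntegral_mul _ hLs hf
    (hB.prod MeasurableSet.univ)]

/-- On `{b < a}` the two functions are ordered and have the same finite integral, so they agree
almost everywhere there; the set is thus null. No σ-finiteness of `μ` is involved. -/
lemma ae_le_of_setLIntegral_eq {μ : Measure Ω} {a b : Ω → ℝ≥0∞} (ha : Measurable a)
    (hb : Measurable b) (h : ∫⁻ ω in {ω | b ω < a ω}, a ω ∂μ = ∫⁻ ω in {ω | b ω < a ω}, b ω ∂μ)
    (hfin : ∫⁻ ω in {ω | b ω < a ω}, b ω ∂μ ≠ ∞) : a ≤ᵐ[μ] b := by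
  have hs : MeasurableSet {ω | b ω < a ω} := measurableSet_lt hb ha
  have hle : b ≤ᵐ[μ.restrict {ω | b ω < a ω}] a :=
    (ae_restrict_mem hs).mono fun ω hω => le_of_lt hω
  have heq := ae_eq_of_ae_le_of_lintegral_le hle hfin ha.aemeasurable h.le
  rw [EventuallyEq, ae_restrict_iff' hs] at heq
  filter_upwards [heq] with ω hω
  by_contra hlt
  exact (not_le.1 hlt).ne (hω (not_le.1 hlt))

/-- Essential uniqueness of the conditional likelihood ratio. -/
lemma IsCondLR.ae_eq {ν : Measure Ω} {C : Set (Measure Ω)} {S : Ω → ℝ≥0∞} (hL : Measurable L)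
    (hQ : Q = P.withDensity L) (hT : Measurable T) (hmap : Q.map T = P.map T) (hPC : P ∈ C)
    (hνP : ν ≪ P) (hS : IsCondLR ν Q C T S) : S =ᵐ[ν] L := by
  obtain ⟨κP, κQ, ν', p, q, hκP, hκQ, hp, hq, hpd, hqd, hSeq⟩ := hS
  have hP := hκP P hPC
  have := hP.1
  have := hκQ.1
  have hpz : ∀ z, Measurable (p z) := fun z => hp.comp measurable_prodMk_left
  have hqz : ∀ z, Measurable (q z) := fun z => hq.comp measurable_prodMk_left
  have hLp : Measurable fun x : 𝒯 × Ω => p x.1 x.2 * L x.2 := hp.mul (hL.comp measurable_snd)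
  have key : ∀ s : Set (𝒯 × Ω), MeasurableSet s → ∀ᵐ z ∂(P.map T),
      ∫⁻ ω in Prod.mk z ⁻¹' s, q z ω ∂(ν' z) = ∫⁻ ω in Prod.mk z ⁻¹' s, p z ω * L ω ∂(ν' z) := by
    intro s hs
    filter_upwards [ae_lintegral_kernel_eq hL hQ hT hmap hP hκQ
      (measurable_one.indicator hs : Measurable (s.indicator (1 : 𝒯 × Ω → ℝ≥0∞)))] with z hz
    have hsz : MeasurableSet (Prod.mk z ⁻¹' s) := measurable_prodMk_left hs
    have hi : ∀ ω, s.indicator (1 : 𝒯 × Ω → ℝ≥0∞) (z, ω)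
        = (Prod.mk z ⁻¹' s).indicator (1 : Ω → ℝ≥0∞) ω := fun ω => rfl
    simp only [hi] at hz
    have hm : Measurable fun ω => L ω * (Prod.mk z ⁻¹' s).indicator (1 : Ω → ℝ≥0∞) ω :=
      hL.mul (measurable_one.indicator hsz)
    rw [lintegral_indicator_one hsz, hqd, withDensity_apply _ hsz, hpd,
      lintegral_withDensity_eq_lintegral_mul _ (hpz z) hm] at hz
    rw [hz, ← lintegral_indicator hsz]
    refine lintegral_congr fun ω => ?_
    by_cases hω : ω ∈ Prod.mk z ⁻¹' s <;> simp [hω]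
  have hz : ∀ᵐ z ∂(P.map T), ∀ᵐ ω ∂(κP z), q z ω / p z ω = L ω := by
    -- As the null set in `key` depends on the test set, only two jointly measurable sets are used;
    -- together their fibres decide whether `q z = p z * L`.
    filter_upwards [key {x | p x.1 x.2 * L x.2 < q x.1 x.2} (measurableSet_lt hLp hq),
      key {x | q x.1 x.2 < p x.1 x.2 * L x.2} (measurableSet_lt hq hLp)] with z h1 h2
    have hLz : Measurable fun ω => p z ω * L ω := (hpz z).mul hL
    have hint : ∀ {κ : Kernel 𝒯 Ω} [IsMarkovKernel κ] {f : Ω → ℝ≥0∞},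
        κ z = (ν' z).withDensity f → ∫⁻ ω, f ω ∂(ν' z) ≠ ∞ := by
      intro κ _ f h
      rw [← setLIntegral_univ, ← withDensity_apply _ MeasurableSet.univ, ← h]
      simp
    have hfin : ∀ s : Set Ω, ∫⁻ ω in s, q z ω ∂(ν' z) ≠ ∞ := fun s =>
      ne_top_of_le_ne_top (hint (hqd z)) (setLIntegral_le_lintegral _ _)
    have hle1 : q z ≤ᵐ[ν' z] fun ω => p z ω * L ω :=
      ae_le_of_setLIntegral_eq (hqz z) hLz h1 (by
        have h1' : ∫⁻ ω in {ω | p z ω * L ω < q z ω}, q z ω ∂(ν' z)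
          = ∫⁻ ω in {ω | p z ω * L ω < q z ω}, p z ω * L ω ∂(ν' z) := h1
        rw [← h1']
        exact hfin _)
    have hle2 : (fun ω => p z ω * L ω) ≤ᵐ[ν' z] q z :=
      ae_le_of_setLIntegral_eq hLz (hqz z) h2.symm (hfin _)
    rw [hpd, ae_withDensity_iff (hpz z)]
    filter_upwards [hle1, hle2, ae_lt_top (hpz z) (hint (hpd z))] with ω h1 h2 ht h0
    rw [le_antisymm h1 h2, mul_comm, ENNReal.mul_div_cancel_right h0 ht.ne]
  -- The product of the law of `T` with `κP` is the law of `(T ω, ω)` under `P`, so the fibrewise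
  -- identity can be evaluated at `z = T ω`.
  have hMae : ∀ᵐ x ∂(P.map T ⊗ₘ κP), q x.1 x.2 / p x.1 x.2 = L x.2 := by
    have hms : MeasurableSet {x : 𝒯 × Ω | q x.1 x.2 / p x.1 x.2 = L x.2} :=
      measurableSet_eq_fun (hq.div hp) (hL.comp measurable_snd)
    rwa [Measure.ae_compProd_iff hms]
  rw [← hP.2] at hMae
  have hPae := ae_of_ae_map (hT.prodMk measurable_id).aemeasurable hMae
  exact hSeq.trans (hνP.ae_le hPae)

lemma isRegCondDistrib_condDistrib [StandardBorelSpace Ω] [Nonempty Ω] (P : Measure Ω)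
    [IsFiniteMeasure P] (T : Ω → 𝒯) : IsRegCondDistrib P T (condDistrib id T P) :=
  ⟨inferInstance, (compProd_map_condDistrib aemeasurable_id).symm⟩

/-- The likelihood ratio is a version of the conditional likelihood ratio given a sufficient
statistic that has the same distribution under the alternative and an element of the null. -/
lemma isCondLR_likelihoodRatio [StandardBorelSpace Ω] [Nonempty Ω] [IsProbabilityMeasure Q]
    {ν : Measure Ω} {C : Set (Measure Ω)} (hL : Measurable L)
    (hQ : Q = P.withDensity L) (hT : Measurable T) (hmap : Q.map T = P.map T)
    (hC : ∀ P' ∈ C, ∃ h : 𝒯 → ℝ≥0∞, Measurable h ∧ P' = P.withDensity fun ω => h (T ω))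
    (hνP : ν ≪ P) : IsCondLR ν Q C T L := by
  set κ := condDistrib id T P
  have hκ : IsRegCondDistrib P T κ := isRegCondDistrib_condDistrib P T
  have hmark : IsMarkovKernel κ := hκ.1
  have : IsProbabilityMeasure (P.map T) := Measure.isProbabilityMeasure_map hT.aemeasurable
  let k : 𝒯 → ℝ≥0∞ := fun z => ∫⁻ ω, L ω ∂(κ z)
  have hk : Measurable k := hL.lintegral_kernel
  have hk1 : ∀ᵐ z ∂(P.map T), k z = 1 := by
    filter_upwards [ae_lintegral_kernel_eq hL hQ hT hmap hκ (isRegCondDistrib_condDistrib Q T)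
      (measurable_one : Measurable (1 : 𝒯 × Ω → ℝ≥0∞))] with z hz
    simpa using hz.symm
  -- `L·κ z` has mass `1` only for almost every `z`, whereas a Markov kernel needs it for all; on
  -- the exceptional fibres the density is reset to `1`.
  let g : 𝒯 → Ω → ℝ≥0∞ := fun z ω => if k z = 1 then L ω else 1
  have hg : Measurable (Function.uncurry g) :=
    Measurable.ite ((hk.comp measurable_fst) (measurableSet_singleton 1))
      (hL.comp measurable_snd) measurable_const
  have hgm : IsMarkovKernel (κ.withDensity g) := by
    refine ⟨fun z => ⟨?_⟩⟩
    rw [Kernel.withDensity_apply _ hg, withDensity_apply _ MeasurableSet.univ, setLIntegral_univ]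
    by_cases hz : k z = 1
    · simp only [g, hz, if_true]
      exact hz
    · simp [g, hz]
  have hkx : ∀ᵐ x ∂(P.map T ⊗ₘ κ), k x.1 = 1 := by
    have hms : MeasurableSet {x : 𝒯 × Ω | k x.1 = 1} :=
      (hk.comp measurable_fst) (measurableSet_singleton 1)
    rw [Measure.ae_compProd_iff hms]
    exact hk1.mono fun z hz => Eventually.of_forall fun _ => hz
  -- The common underlying measure is `κ` itself, so the null has conditional density `1` and the
  -- alternative `g`.
  refine ⟨κ, κ.withDensity g, κ, fun _ _ => 1, g, ?_, ⟨hgm, ?_⟩, measurable_const, hg, ?_, ?_, ?_⟩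
  · intro P' hP'
    obtain ⟨h, hh, rfl⟩ := hC P' hP'
    exact hκ.withDensity_comp hT hh
  · rw [hmap, Measure.compProd_withDensity hg, hQ]
    rw [map_withDensity_comp P (f := fun ω => (T ω, ω)) (hT.prodMk measurable_id)
      (g := fun x => L x.2) (hL.comp measurable_snd), hκ.2]
    refine withDensity_congr_ae (hkx.mono fun x hx => ?_)
    simp [g, hx]
  · intro z
    exact (withDensity_one).symm
  · intro z
    exact Kernel.withDensity_apply _ hg z
  · refine hνP.ae_le ?_
    filter_upwards [ae_of_ae_map hT.aemeasurable hk1] with ω hω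
    simp [g, hω]

end Conditional

namespace RegularExpFamily

/-! ### Densities of a regular exponential family -/

variable {𝒰 : Type*} [MeasurableSpace 𝒰] {ν : Measure 𝒰} {d : ℕ} {F : RegularExpFamily ν d}
  {μ μs : EuclideanSpace ℝ (Fin d)}

lemma canonicalOf_mem (hμ : μ ∈ F.meanSpace) : F.canonicalOf μ ∈ F.canonicalSpace := by
  have h : ∃ β ∈ F.canonicalSpace, F.meanOf β = μ := hμ
  rw [canonicalOf, dif_pos h]
  exact h.choose_spec.1

lemma measurable_exp_inner {𝒯 : Type*} [MeasurableSpace 𝒯] {T : 𝒯 → EuclideanSpace ℝ (Fin d)}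
    (hT : Measurable T) (γ : EuclideanSpace ℝ (Fin d)) :
    Measurable fun t => ENNReal.ofReal (Real.exp ⟪γ, T t⟫) :=
  (Real.measurable_exp.comp (hT.const_inner)).ennreal_ofReal

lemma measurable_unnormalized (F : RegularExpFamily ν d) (β : EuclideanSpace ℝ (Fin d)) :
    Measurable fun u => ENNReal.ofReal (Real.exp ⟪β, F.X u⟫) * F.carrier u :=
  (measurable_exp_inner F.measurable_X β).mul F.measurable_carrier

lemma measurable_density (F : RegularExpFamily ν d) (μ : EuclideanSpace ℝ (Fin d)) :
    Measurable (F.density μ) :=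
  (F.measurable_unnormalized _).div_const _

lemma ofReal_exp_ne_zero (x : ℝ) : ENNReal.ofReal (Real.exp x) ≠ 0 :=
  (ENNReal.ofReal_pos.2 (Real.exp_pos x)).ne'

lemma normalizer_ne_zero [NeZero ν] (β : EuclideanSpace ℝ (Fin d)) : F.normalizer β ≠ 0 := by
  intro h
  rw [normalizer, lintegral_eq_zero_iff (F.measurable_unnormalized β)] at h
  have : ∀ᵐ _ ∂ν, False := by
    filter_upwards [h, F.carrier_ne_zero] with u hu hc
    exact mul_ne_zero (ofReal_exp_ne_zero _) hc hu
  simp only [ae_iff, not_false_eq_true, Set.ofPred_true, Measure.measure_univ_eq_zero] at this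
  exact NeZero.ne ν this

lemma ae_density_ne [NeZero ν] (hμ : μ ∈ F.meanSpace) :
    ∀ᵐ u ∂ν, F.density μ u ≠ 0 ∧ F.density μ u ≠ ∞ := by
  have hZ : F.normalizer (F.canonicalOf μ) < ∞ := canonicalOf_mem hμ
  -- Finiteness of `carrier` almost everywhere is not assumed; it enters through finiteness of the
  -- normalizer.
  filter_upwards [F.carrier_ne_zero, ae_lt_top (F.measurable_unnormalized _) hZ.ne] with u h0 ht
  exact ⟨ENNReal.div_ne_zero.2 ⟨mul_ne_zero (ofReal_exp_ne_zero _) h0, hZ.ne⟩,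
    ENNReal.div_ne_top ht.ne (normalizer_ne_zero _)⟩

lemma isProbabilityMeasure_dist [NeZero ν] (hμ : μ ∈ F.meanSpace) :
    IsProbabilityMeasure (F.dist μ) := by
  have hZ : F.normalizer (F.canonicalOf μ) < ∞ := canonicalOf_mem hμ
  refine ⟨?_⟩
  rw [dist, withDensity_apply _ MeasurableSet.univ, setLIntegral_univ]
  simp only [density, canonicalDensity, div_eq_mul_inv]
  rw [lintegral_mul_const _ (F.measurable_unnormalized _)]
  exact ENNReal.mul_inv_cancel (normalizer_ne_zero _) hZ.ne

/-- Any two elements of the family have a likelihood ratio that is log-affine in `X`. -/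
lemma exists_density_eq_mul [NeZero ν] (hμs : μs ∈ F.meanSpace) (μ : EuclideanSpace ℝ (Fin d)) :
    ∃ (γ : EuclideanSpace ℝ (Fin d)) (c : ℝ≥0∞), ∀ u,
      F.density μ u = F.density μs u * (ENNReal.ofReal (Real.exp ⟪γ, F.X u⟫) * c) := by
  have hZ : F.normalizer (F.canonicalOf μs) < ∞ := canonicalOf_mem hμs
  refine ⟨F.canonicalOf μ - F.canonicalOf μs,
    F.normalizer (F.canonicalOf μs) * (F.normalizer (F.canonicalOf μ))⁻¹, fun u => ?_⟩
  have hexp : ENNReal.ofReal (Real.exp ⟪F.canonicalOf μ, F.X u⟫)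
      = ENNReal.ofReal (Real.exp ⟪F.canonicalOf μs, F.X u⟫)
        * ENNReal.ofReal (Real.exp ⟪F.canonicalOf μ - F.canonicalOf μs, F.X u⟫) := by
    rw [← ENNReal.ofReal_mul (Real.exp_pos _).le, ← Real.exp_add, inner_sub_left]
    congr 2
    ring
  simp only [density, canonicalDensity, div_eq_mul_inv]
  rw [hexp]
  calc _ = ENNReal.ofReal (Real.exp ⟪F.canonicalOf μs, F.X u⟫)
        * ENNReal.ofReal (Real.exp ⟪F.canonicalOf μ - F.canonicalOf μs, F.X u⟫) * F.carrier u
        * (F.normalizer (F.canonicalOf μ))⁻¹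
        * (F.normalizer (F.canonicalOf μs) * (F.normalizer (F.canonicalOf μs))⁻¹) := by
        rw [ENNReal.mul_inv_cancel (normalizer_ne_zero _) hZ.ne, mul_one]
    _ = _ := by ring

lemma exists_dist_eq_withDensity [NeZero ν] (hμs : μs ∈ F.meanSpace)
    (μ : EuclideanSpace ℝ (Fin d)) :
    ∃ (γ : EuclideanSpace ℝ (Fin d)) (c : ℝ≥0∞), F.dist μ
      = (F.dist μs).withDensity fun u => ENNReal.ofReal (Real.exp ⟪γ, F.X u⟫) * c := by
  obtain ⟨γ, c, h⟩ := exists_density_eq_mul hμs μ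
  refine ⟨γ, c, ?_⟩
  rw [dist, dist, ← withDensity_mul _ (F.measurable_density μs)
    ((measurable_exp_inner F.measurable_X γ).mul_const c)]
  congr 1
  exact funext h

lemma exists_pi_dist_eq_withDensity [NeZero ν] (hμs : μs ∈ F.meanSpace) (hμ : μ ∈ F.meanSpace)
    (n : ℕ) : ∃ (γ : EuclideanSpace ℝ (Fin d)) (c : ℝ≥0∞),
      (Measure.pi fun _ : Fin n => F.dist μ) = (Measure.pi fun _ : Fin n => F.dist μs).withDensity
        fun u => ∏ i, (ENNReal.ofReal (Real.exp ⟪γ, F.X (u i)⟫) * c) := by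
  have := isProbabilityMeasure_dist hμs
  have hprob := isProbabilityMeasure_dist hμ
  obtain ⟨γ, c, h⟩ := exists_dist_eq_withDensity hμs μ
  refine ⟨γ, c, ?_⟩
  rw [h] at hprob
  rw [h, pi_withDensity _ ((measurable_exp_inner F.measurable_X γ).mul_const c)]

lemma measurable_Xn (F : RegularExpFamily ν d) (n : ℕ) : Measurable (F.Xn n) :=
  measurable_pi_lambda _ fun i => F.measurable_X.comp (measurable_pi_apply i)

lemma measurable_scaled_sum (n : ℕ) :
    Measurable fun x : Fin n → EuclideanSpace ℝ (Fin d) => (Real.sqrt n)⁻¹ • ∑ i, x i := by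
  have h : Measurable fun x : Fin n → EuclideanSpace ℝ (Fin d) => ∑ i, x i :=
    Finset.measurable_sum _ fun i _ => measurable_pi_apply i
  exact h.const_smul (Real.sqrt n)⁻¹

lemma measurable_Z (F : RegularExpFamily ν d) (n : ℕ) : Measurable (F.Z n) :=
  (measurable_scaled_sum n).comp (F.measurable_Xn n)

lemma null_withDensity_X [NeZero ν] (hμs : μs ∈ F.meanSpace) :
    ∀ P ∈ F.null, ∃ h : EuclideanSpace ℝ (Fin d) → ℝ≥0∞, Measurable h ∧
      P = (F.dist μs).withDensity fun u => h (F.X u) := by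
  rintro P ⟨μ, -, rfl⟩
  obtain ⟨γ, c, h⟩ := exists_dist_eq_withDensity hμs μ
  exact ⟨fun x => ENNReal.ofReal (Real.exp ⟪γ, x⟫) * c,
    (measurable_exp_inner measurable_id γ).mul_const c, h⟩

/-- `Xⁿ` is sufficient. -/
lemma nullN_withDensity_Xn [NeZero ν] (hμs : μs ∈ F.meanSpace) (n : ℕ) :
    ∀ P ∈ F.nullN n, ∃ h : (Fin n → EuclideanSpace ℝ (Fin d)) → ℝ≥0∞, Measurable h ∧
      P = (Measure.pi fun _ => F.dist μs).withDensity fun u => h (F.Xn n u) := by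
  rintro P ⟨μ, hμ, rfl⟩
  obtain ⟨γ, c, h⟩ := exists_pi_dist_eq_withDensity hμs hμ n
  exact ⟨fun x => ∏ i, (ENNReal.ofReal (Real.exp ⟪γ, x i⟫) * c),
    measurable_prod_apply ((measurable_exp_inner measurable_id γ).mul_const c), h⟩

/-- `Z` is sufficient. -/
lemma nullN_withDensity_Z [NeZero ν] (hμs : μs ∈ F.meanSpace) {n : ℕ} (hn : 1 ≤ n) :
    ∀ P ∈ F.nullN n, ∃ h : EuclideanSpace ℝ (Fin d) → ℝ≥0∞, Measurable h ∧
      P = (Measure.pi fun _ => F.dist μs).withDensity fun u => h (F.Z n u) := by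
  rintro P ⟨μ, hμ, rfl⟩
  obtain ⟨γ, c, h⟩ := exists_pi_dist_eq_withDensity hμs hμ n
  have hT : Measurable fun z : EuclideanSpace ℝ (Fin d) => Real.sqrt n • z :=
    measurable_const_smul _
  -- The factors multiply to `exp ⟪γ, ∑ X_i⟫ * c ^ n`, and `∑ X_i = √n • Z` since `√n ≠ 0`.
  refine ⟨fun z => ENNReal.ofReal (Real.exp ⟪γ, Real.sqrt n • z⟫) * c ^ n,
    (measurable_exp_inner hT γ).mul_const _, h.trans (congrArg _ (funext fun u => ?_))⟩
  have hn0 : Real.sqrt n ≠ 0 := (Real.sqrt_pos.2 (by exact_mod_cast hn)).ne'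
  simp only [Z]
  rw [smul_inv_smul₀ hn0, inner_sum, Real.exp_sum,
    ENNReal.ofReal_prod_of_nonneg fun i _ => (Real.exp_pos _).le, Finset.prod_mul_distrib]
  simp

lemma isProbabilityMeasure_of_mem_null [NeZero ν] : ∀ P ∈ F.null, IsProbabilityMeasure P := by
  rintro P ⟨μ, hμ, rfl⟩
  exact isProbabilityMeasure_dist hμ

lemma isProbabilityMeasure_of_mem_nullN [NeZero ν] (n : ℕ) :
    ∀ P ∈ F.nullN n, IsProbabilityMeasure P := by
  rintro P ⟨μ, hμ, rfl⟩
  have := isProbabilityMeasure_dist hμ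
  infer_instance

end RegularExpFamily

/-- The likelihood ratio is an e-variable if the null is generated by a statistic that has the same
distribution under the alternative and an element of the null. -/
lemma isEVariable_likelihoodRatio {Ω 𝒯 : Type*} [MeasurableSpace Ω] [MeasurableSpace 𝒯]
    {P : Measure Ω} {C : Set (Measure Ω)} {L : Ω → ℝ≥0∞} (hL : Measurable L) {T : Ω → 𝒯}
    (hT : Measurable T) (hmap : (P.withDensity L).map T = P.map T)
    (hprob : ∀ P' ∈ C, IsProbabilityMeasure P')
    (hC : ∀ P' ∈ C, ∃ h : 𝒯 → ℝ≥0∞, Measurable h ∧ P' = P.withDensity fun ω => h (T ω)) :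
    IsEVariable C L := by
  refine ⟨hL, fun P' hP' => ?_⟩
  have := hprob P' hP'
  obtain ⟨h, hh, rfl⟩ := hC P' hP'
  rw [lintegral_likelihoodRatio_eq hL hT hmap hh]
  exact prob_le_one

end

end EVal

/-! ### The main theorem: one outcome, then `n` outcomes. -/

theorem mainTheorem9 {𝒰 : Type*} [MeasurableSpace 𝒰] {d : ℕ} (ν : Measure 𝒰) [SigmaFinite ν]
    (F : EVal.RegularExpFamily ν d)
    (q : 𝒰 → ℝ≥0∞) (hq : Measurable q) (hQ : IsProbabilityMeasure (ν.withDensity q))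
    (hνQ : ν ≪ ν.withDensity q)
    (μs : EuclideanSpace ℝ (Fin d)) (hμs : μs ∈ F.meanSpace)
    (hX : (ν.withDensity q).map F.X = (F.dist μs).map F.X)
    (n : ℕ) (hn : 1 ≤ n) :
    -- the e-variables exist; `q(Uⁿ) / p_{μ*}(Uⁿ)` is a version of each of them
    (F.IsRIP q n (fun u => (∏ i, q (u i)) / ∏ i, F.density μs (u i)) ∧
      F.IsSeqRIP q n (fun u => (∏ i, q (u i)) / ∏ i, F.density μs (u i)) ∧
      (StandardBorelSpace 𝒰 →
        F.IsCOND q n (fun u => (∏ i, q (u i)) / ∏ i, F.density μs (u i)) ∧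
        F.IsCondX q n (fun u => (∏ i, q (u i)) / ∏ i, F.density μs (u i)))) ∧
    -- all versions of each of them are almost surely equal to it, with the stated e-power
    (∀ S : (Fin n → 𝒰) → ℝ≥0∞,
      (F.IsCOND q n S ∨ F.IsCondX q n S ∨
        (InformationTheory.klDiv (ν.withDensity q) (F.dist μs) ≠ ∞ ∧
          (F.IsRIP q n S ∨ F.IsSeqRIP q n S))) →
      (S =ᵐ[Measure.pi fun _ => ν] fun u => (∏ i, q (u i)) / ∏ i, F.density μs (u i)) ∧
      ∀ R : Measure 𝒰, IsProbabilityMeasure R → R ≪ ν →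
        EVal.LogExpDefined R (fun u => q u / F.density μs u) →
        EVal.LogExpDefined (Measure.pi fun _ : Fin n => R) S ∧
        EVal.expLog (Measure.pi fun _ : Fin n => R) S =
          (n : EReal) * EVal.expLog R (fun u => q u / F.density μs u)) := by
  have hν0 : NeZero ν := ⟨fun h => by
    have := hQ.measure_univ
    simp [h] at this⟩
  have hp := F.measurable_density μs
  have hpne := EVal.RegularExpFamily.ae_density_ne hμs
  have hPs := EVal.RegularExpFamily.isProbabilityMeasure_dist hμs
  have hPs' : IsProbabilityMeasure (ν.withDensity (F.density μs)) := hPs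
  have hqne : ∀ᵐ u ∂ν, q u ≠ 0 ∧ q u ≠ ∞ := hνQ.ae_le (EVal.ae_density_ne hq)
  have hLm : Measurable fun u => q u / F.density μs u := hq.div hp
  have hLne : ∀ᵐ u ∂ν, q u / F.density μs u ≠ 0 ∧ q u / F.density μs u ≠ ∞ := by
    filter_upwards [hpne, hqne] with u h1 h2
    exact ⟨ENNReal.div_ne_zero.2 ⟨h2.1, h1.2⟩, ENNReal.div_ne_top h2.2 h1.1⟩
  have hνP : ν ≪ F.dist μs := withDensity_absolutelyContinuous' hp.aemeasurable
    (hpne.mono fun u h => h.1)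
  have hQP : ν.withDensity q = (F.dist μs).withDensity fun u => q u / F.density μs u :=
    EVal.withDensity_eq_withDensity_div hp hq hpne
  -- a single outcome
  have hE : EVal.IsEVariable F.null fun u => q u / F.density μs u :=
    EVal.isEVariable_likelihoodRatio hLm F.measurable_X (hQP ▸ hX)
      EVal.RegularExpFamily.isProbabilityMeasure_of_mem_null
      (EVal.RegularExpFamily.null_withDensity_X hμs)
  have hRIPr : EVal.IsRIPr ν q F.null (F.density μs) :=
    EVal.isRIPr_of_isEVariable hp hq hpne
      EVal.RegularExpFamily.isProbabilityMeasure_of_mem_null ⟨μs, hμs, rfl⟩ hE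
  -- `n` outcomes
  let Ln : (Fin n → 𝒰) → ℝ≥0∞ := fun u => (∏ i, q (u i)) / ∏ i, F.density μs (u i)
  have hqn : Measurable fun u : Fin n → 𝒰 => ∏ i, q (u i) := EVal.measurable_prod_apply hq
  have hpn : Measurable fun u : Fin n → 𝒰 => ∏ i, F.density μs (u i) :=
    EVal.measurable_prod_apply hp
  have hLn : Measurable Ln := hqn.div hpn
  have hLnprod : Ln =ᵐ[Measure.pi fun _ => ν] fun u => ∏ i, q (u i) / F.density μs (u i) := by
    filter_upwards [EVal.ae_pi_of_ae hpne] with u hu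
    exact EVal.prod_div_prod hu
  have hpnne : ∀ᵐ u ∂(Measure.pi fun _ : Fin n => ν),
      ∏ i, F.density μs (u i) ≠ 0 ∧ ∏ i, F.density μs (u i) ≠ ∞ := by
    filter_upwards [EVal.ae_pi_of_ae hpne] with u hu
    exact ⟨Finset.prod_ne_zero_iff.2 fun i _ => (hu i).1, ENNReal.prod_ne_top fun i _ => (hu i).2⟩
  have hQn := EVal.pi_withDensity (n := n) ν hq
  have hPn : (Measure.pi fun _ : Fin n => F.dist μs) = _ := EVal.pi_withDensity (n := n) ν hp
  have hQnP : (Measure.pi fun _ : Fin n => ν.withDensity q)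
      = (Measure.pi fun _ : Fin n => F.dist μs).withDensity Ln := by
    rw [hQn, hPn]
    exact EVal.withDensity_eq_withDensity_div hpn hqn hpnne
  have hQnprob : IsProbabilityMeasure
      ((Measure.pi fun _ : Fin n => ν).withDensity fun u => ∏ i, q (u i)) := by
    rw [← hQn]; infer_instance
  have hνPn := EVal.pi_absolutelyContinuous (n := n) hνP
  have hνQn := EVal.pi_absolutelyContinuous (n := n) hνQ
  have hXn : (Measure.pi fun _ : Fin n => ν.withDensity q).map (F.Xn n)
      = (Measure.pi fun _ : Fin n => F.dist μs).map (F.Xn n) := by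
    have := Measure.isProbabilityMeasure_map (μ := ν.withDensity q) F.measurable_X.aemeasurable
    have := Measure.isProbabilityMeasure_map (μ := F.dist μs) F.measurable_X.aemeasurable
    have h1 := Measure.pi_map_pi (μ := fun _ : Fin n => ν.withDensity q)
      (fun _ => F.measurable_X.aemeasurable)
    have h2 := Measure.pi_map_pi (μ := fun _ : Fin n => F.dist μs)
      (fun _ => F.measurable_X.aemeasurable)
    simp only [hX] at h1
    exact h1.trans h2.symm
  have hZ : (Measure.pi fun _ : Fin n => ν.withDensity q).map (F.Z n)
      = (Measure.pi fun _ : Fin n => F.dist μs).map (F.Z n) := by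
    have hms := EVal.RegularExpFamily.measurable_scaled_sum (d := d) n
    have hc : F.Z n = (fun x => (Real.sqrt n)⁻¹ • ∑ i, x i) ∘ F.Xn n := rfl
    rw [hc, ← Measure.map_map hms (F.measurable_Xn n), hXn,
      Measure.map_map hms (F.measurable_Xn n)]
  have hprobN := EVal.RegularExpFamily.isProbabilityMeasure_of_mem_nullN (F := F) n
  have hmemN : (Measure.pi fun _ : Fin n => F.dist μs) ∈ F.nullN n := ⟨μs, hμs, rfl⟩
  have hmemN' : ((Measure.pi fun _ : Fin n => ν).withDensity
      fun u => ∏ i, F.density μs (u i)) ∈ F.nullN n := hPn ▸ hmemN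
  have hEn : EVal.IsEVariable (F.nullN n) Ln :=
    EVal.isEVariable_likelihoodRatio hLn (F.measurable_Xn n) (hQnP ▸ hXn) hprobN
      (EVal.RegularExpFamily.nullN_withDensity_Xn hμs n)
  have hpower : ∀ R : Measure 𝒰, IsProbabilityMeasure R → R ≪ ν →
      EVal.LogExpDefined R (fun u => q u / F.density μs u) →
      EVal.LogExpDefined (Measure.pi fun _ : Fin n => R) Ln ∧
      EVal.expLog (Measure.pi fun _ : Fin n => R) Ln =
        (n : EReal) * EVal.expLog R (fun u => q u / F.density μs u) := by
    intro R hR hRν hdef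
    have hae := (EVal.pi_absolutelyContinuous (n := n) hRν).ae_le hLnprod
    rw [EVal.logExpDefined_congr hae, EVal.expLog_congr hae]
    exact EVal.expLog_pi_prod hn hLm (hRν.ae_le hLne) hdef
  refine ⟨⟨?_, ?_, fun hSB => ⟨?_, ?_⟩⟩, fun S hS => ?_⟩
  · exact ⟨_, EVal.isRIPr_of_isEVariable hpn hqn hpnne hprobN hmemN' hEn, ae_eq_rfl⟩
  · exact ⟨fun _ _ => F.density μs, fun _ => hp.comp measurable_snd, fun _ _ _ => hRIPr, hLnprod⟩
  · have : Nonempty (Fin n → 𝒰) :=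
      nonempty_of_isProbabilityMeasure (Measure.pi fun _ : Fin n => ν.withDensity q)
    exact EVal.isCondLR_likelihoodRatio hLn hQnP (F.measurable_Z n) hZ
      (EVal.RegularExpFamily.nullN_withDensity_Z hμs hn) hνPn
  · have : Nonempty (Fin n → 𝒰) :=
      nonempty_of_isProbabilityMeasure (Measure.pi fun _ : Fin n => ν.withDensity q)
    exact EVal.isCondLR_likelihoodRatio hLn hQnP (F.measurable_Xn n) hXn
      (EVal.RegularExpFamily.nullN_withDensity_Xn hμs n) hνPn
  · have hSL : S =ᵐ[Measure.pi fun _ => ν] Ln := by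
      rcases hS with hS | hS | ⟨hkl, hS⟩
      · exact EVal.IsCondLR.ae_eq hLn hQnP (F.measurable_Z n) hZ hmemN hνPn hS
      · exact EVal.IsCondLR.ae_eq hLn hQnP (F.measurable_Xn n) hXn hmemN hνPn hS
      have hfin1 : EVal.expLog (ν.withDensity q) (fun u => q u / F.density μs u) ≠ ⊤ := by
        have hprob : IsProbabilityMeasure
            ((F.dist μs).withDensity fun u => q u / F.density μs u) := hQP ▸ hQ
        have h := EVal.expLog_withDensity_eq_klDiv (P := F.dist μs) hLm
        rw [← hQP] at h
        rw [h]
        simpa using hkl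
      rcases hS with ⟨r, hr, hSr⟩ | ⟨r, hrm, hr, hSr⟩
      · have hdef : EVal.LogExpDefined (ν.withDensity q) (fun u => q u / F.density μs u) := by
          refine Or.inr ?_
          have h := EVal.lintegral_neg_log_density_ne_top (P := F.dist μs) hLm
          rwa [← hQP] at h
        -- The e-power identity with `R = Q` reads `D(Qⁿ‖Pⁿ) = n D(Q‖P)`, which carries finiteness
        -- over to `n` outcomes as uniqueness requires.
        have hpow := (hpower _ hQ (withDensity_absolutelyContinuous _ _) hdef).2
        have hbot : EVal.expLog (ν.withDensity q) (fun u => q u / F.density μs u) ≠ ⊥ := by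
          have h := EVal.lintegral_neg_log_density_ne_top (P := F.dist μs) hLm
          rw [← hQP] at h
          exact EVal.expLog_ne_bot h
        have hfinn : EVal.expLog ((Measure.pi fun _ : Fin n => ν).withDensity
            fun u => ∏ i, q (u i)) Ln ≠ ⊤ := by
          rw [← hQn, hpow]
          lift EVal.expLog (ν.withDensity q) (fun u => q u / F.density μs u) to ℝ
            using ⟨hfin1, hbot⟩ with x
          exact EReal.coe_ne_top (n * x)
        exact hSr.trans (hr.ae_eq hpn hqn hpnne hprobN (hQn ▸ hνQn) hmemN' hEn hfinn)
      -- For each fixed past, uniqueness of the single-outcome RIPr gives equality for almost every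
      -- next outcome; `ae_past` turns this into a statement about sequences.
      · have hi : ∀ i : Fin n, ∀ᵐ u ∂(Measure.pi fun _ : Fin n => ν),
            q (u i) / r i (EVal.past u i) (u i) = q (u i) / F.density μs (u i) := by
          intro i
          have hms : MeasurableSet {x : (Fin (i : ℕ) → 𝒰) × 𝒰 |
              q x.2 / r i x.1 x.2 = q x.2 / F.density μs x.2} :=
            measurableSet_eq_fun ((hq.comp measurable_snd).div (hrm i))
              (hLm.comp measurable_snd)
          exact EVal.ae_past i hms fun v => (hr i i.2 v).ae_eq hp hq hpne
            EVal.RegularExpFamily.isProbabilityMeasure_of_mem_null hνQ ⟨μs, hμs, rfl⟩ hE hfin1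
        refine (hSr.trans ?_).trans hLnprod.symm
        filter_upwards [eventually_all.2 hi] with u hu
        exact Finset.prod_congr rfl fun i _ => hu i
    refine ⟨hSL, fun R hR hRν hdef => ?_⟩
    have hae := (EVal.pi_absolutelyContinuous (n := n) hRν).ae_le hSL
    rw [EVal.logExpDefined_congr hae, EVal.expLog_congr hae]
    exact hpower R hR hRν hdef
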